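/- Let $(M,g)$ be a spacetime, i.e. a smooth four-dimensional Hausdorff manifold $M$ with a smooth Lorentzian metric $g$ of signature $(-,+,+,+)$ and a time orientation. Let $U\subseteq M$ be an open set that is globally conformally flat: there are a single smooth function $\Omega:U\to(0,\infty)$ and a smooth flat Lorentzian metric $\eta$ on $U$ (vanishing Riemann tensor) with $g=\Omega^2\eta$ on $U$. Then no truncated future wandering null geodesic of $(M,g)$ is contained in $U$. Here a point $\gamma(b)$ of a geodesic $\gamma$ is conjugate to $\gamma(a)$ along $\gamma$, $a\neq b$, if some Jacobi field along $\gamma$ (a solution of the geodesic deviation equation $\frac{D^2J}{ds^2}=-R(J,\gamma')\gamma'$) that is not identically zero vanishes at $a$ and at $b$. A future wandering null geodesic from $p$ is a future-directed null geodesic $\gamma:[0,\infty)\to M$ with $\gamma(0)=p$, affinely parametrized and complete (hence inextendible) to the future, along which there are infinitely many parameters $t>0$ with $\gamma(t)$ conjugate to $p$. If $t_1>0$ is the first of these parameters, the restriction of $\gamma$ to $[t_1,\infty)$ is called a truncated future wandering null geodesic. -/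

import Mathlib

open Set
open scoped Manifold ContDiff

noncomputable section

/-- The model space of a four-dimensional spacetime manifold. -/
abbrev E4 : Type := EuclideanSpace ℝ (Fin 4)

/-! ### Tensor calculus in coordinates: a field of bilinear forms `G` on `E4` -/

/-- The Christoffel symbols of the first kind, as the covector
`z ↦ ½ (∂_v G(w, z) + ∂_w G(v, z) - ∂_z G(v, w))`. -/
def christoffelLower (G : E4 → E4 →L[ℝ] E4 →L[ℝ] ℝ) (y v w : E4) : E4 →L[ℝ] ℝ :=
  (1 / 2 : ℝ) • (fderiv ℝ G y v w + fderiv ℝ G y w v - ((fderiv ℝ G y).flip v).flip w)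

/-- The Christoffel symbols `Γ(v, w)` of the Levi-Civita connection: the index of
`christoffelLower` is raised with the inverse of `v ↦ G(v, ·)`. -/
def christoffel (G : E4 → E4 →L[ℝ] E4 →L[ℝ] ℝ) (y v w : E4) : E4 :=
  (G y).inverse (christoffelLower G y v w)

/-- The Riemann tensor `R(u, v) w = ∇_u ∇_v w - ∇_v ∇_u w`, for `u v w` constant in coordinates. -/
def riemann (G : E4 → E4 →L[ℝ] E4 →L[ℝ] ℝ) (y u v w : E4) : E4 :=
  fderiv ℝ (fun z => christoffel G z v w) y u - fderiv ℝ (fun z => christoffel G z u w) y v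
    + christoffel G y u (christoffel G y v w) - christoffel G y v (christoffel G y u w)

variable {M : Type*} [TopologicalSpace M] [ChartedSpace E4 M]

/-! ### Fields of bilinear forms on a manifold -/

variable (M) in
/-- A field of bilinear forms on the tangent spaces of `M` (no regularity yet). -/
abbrev FormField : Type _ :=
  ∀ x : M, TangentSpace 𝓘(ℝ, E4) x →L[ℝ] TangentSpace 𝓘(ℝ, E4) x →L[ℝ] ℝ

/-- The components of a tangent vector `v` at `x` in the chart `φ`. -/
def toChart (φ : OpenPartialHomeomorph M E4) (x : M) (v : TangentSpace 𝓘(ℝ, E4) x) : E4 :=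
  mfderiv 𝓘(ℝ, E4) 𝓘(ℝ, E4) φ x v

/-- The components of a field of bilinear forms in the chart `φ`, as a function of the
coordinates. -/
def coordForm (h : FormField M) (φ : OpenPartialHomeomorph M E4) (y : E4) :
    E4 →L[ℝ] E4 →L[ℝ] ℝ :=
  ContinuousLinearMap.bilinearComp (E := E4) (F := E4) (h (φ.symm y))
    (mfderiv 𝓘(ℝ, E4) 𝓘(ℝ, E4) φ.symm y) (mfderiv 𝓘(ℝ, E4) 𝓘(ℝ, E4) φ.symm y)

/-- `h` is a smooth Lorentzian metric, of signature `(-,+,+,+)`, on the open set `U`. -/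
structure IsLorentzianOn (h : FormField M) (U : Set M) : Prop where
  smooth : ∀ φ ∈ atlas E4 M, ContDiffOn ℝ ∞ (coordForm h φ) (φ.target ∩ φ.symm ⁻¹' U)
  symm : ∀ x ∈ U, ∀ v w, h x v w = h x w v
  signature : ∀ x ∈ U, ∃ e : Module.Basis (Fin 4) ℝ (TangentSpace 𝓘(ℝ, E4) x),
    ∀ i j, h x (e i) (e j) = if i = j then (if i = 0 then -1 else 1) else 0

/-- `h` is flat on the open set `U`: its Riemann tensor vanishes there. -/
def IsFlatOn (h : FormField M) (U : Set M) : Prop :=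
  ∀ φ ∈ atlas E4 M, ∀ x ∈ U ∩ φ.source, ∀ u v w : E4, riemann (coordForm h φ) (φ x) u v w = 0

/-- On `U` the field `g` is `Ω²` times a flat Lorentzian metric, for a single smooth positive
function `Ω` on all of `U`. -/
def IsGloballyConformallyFlatOn (g : FormField M) (U : Set M) : Prop :=
  ∃ (Ω : M → ℝ) (η : FormField M),
    ContMDiffOn 𝓘(ℝ, E4) 𝓘(ℝ, ℝ) ∞ Ω U ∧ (∀ x ∈ U, 0 < Ω x) ∧
    IsLorentzianOn η U ∧ IsFlatOn η U ∧ ∀ x ∈ U, g x = (Ω x) ^ 2 • η x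

/-! ### Geodesics, Jacobi fields and conjugate points

Curves are maps `γ : ℝ → M` of which only the values on an interval `I` matter; derivatives are
taken within `I`. -/

/-- The velocity of `γ` at the parameter `t`. -/
def velocity (γ : ℝ → M) (I : Set ℝ) (t : ℝ) : TangentSpace 𝓘(ℝ, E4) (γ t) :=
  mfderivWithin 𝓘(ℝ, ℝ) 𝓘(ℝ, E4) γ I t (1 : ℝ)

/-- The vector field `W` along `γ` is the Levi-Civita covariant derivative of the vector field `V`
along `γ`: in every chart, `W = V' + Γ(γ', V)`. -/
def IsCovariantDerivAlong (h : FormField M) (γ : ℝ → M) (I : Set ℝ)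
    (V W : ∀ t, TangentSpace 𝓘(ℝ, E4) (γ t)) : Prop :=
  ∀ φ ∈ atlas E4 M, ∀ t ∈ I, γ t ∈ φ.source →
    HasDerivWithinAt (fun s => toChart φ (γ s) (V s))
      (toChart φ (γ t) (W t) - christoffel (coordForm h φ) (φ (γ t))
        (toChart φ (γ t) (velocity γ I t)) (toChart φ (γ t) (V t))) I t

/-- `γ` is an affinely parametrized geodesic on the interval `I`. -/
def IsGeodesicOn (h : FormField M) (γ : ℝ → M) (I : Set ℝ) : Prop :=
  ContMDiffOn 𝓘(ℝ, ℝ) 𝓘(ℝ, E4) ∞ γ I ∧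
    IsCovariantDerivAlong h γ I (velocity γ I) (fun _ => 0)

/-- `J` is a Jacobi field along `γ`, that is, a solution of the geodesic deviation equation
`D² J = - R(J, γ') γ'`. -/
def IsJacobiField (h : FormField M) (γ : ℝ → M) (I : Set ℝ)
    (J : ∀ t, TangentSpace 𝓘(ℝ, E4) (γ t)) : Prop :=
  ∃ DJ DDJ : ∀ t, TangentSpace 𝓘(ℝ, E4) (γ t),
    IsCovariantDerivAlong h γ I J DJ ∧ IsCovariantDerivAlong h γ I DJ DDJ ∧
    ∀ φ ∈ atlas E4 M, ∀ t ∈ I, γ t ∈ φ.source →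
      toChart φ (γ t) (DDJ t) =
        - riemann (coordForm h φ) (φ (γ t)) (toChart φ (γ t) (J t))
            (toChart φ (γ t) (velocity γ I t)) (toChart φ (γ t) (velocity γ I t))

/-- `γ b` is conjugate to `γ a` along `γ`: some Jacobi field that is not identically zero vanishes
at the two distinct parameters `a` and `b`. -/
def IsConjugate (h : FormField M) (γ : ℝ → M) (I : Set ℝ) (a b : ℝ) : Prop :=
  a ∈ I ∧ b ∈ I ∧ a ≠ b ∧ ∃ J : ∀ t, TangentSpace 𝓘(ℝ, E4) (γ t),
    IsJacobiField h γ I J ∧ J a = 0 ∧ J b = 0 ∧ ∃ t ∈ I, J t ≠ 0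

/-! ### Spacetimes and wandering null geodesics -/

variable [IsManifold 𝓘(ℝ, E4) ∞ M]

variable (M) in
/-- A time-oriented Lorentzian metric on `M`; the time orientation is given by a continuous
timelike vector field, declared to be future-directed. -/
structure Spacetime where
  metric : FormField M
  lorentzian : IsLorentzianOn metric univ
  timeField : ∀ x : M, TangentSpace 𝓘(ℝ, E4) x
  continuous_timeField : Continuous fun x => (⟨x, timeField x⟩ : TangentBundle 𝓘(ℝ, E4) M)
  timelike_timeField : ∀ x, metric x (timeField x) (timeField x) < 0

/-- The future-directed, future-complete null geodesics with starting point `γ 0`. Completeness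
means that the affine parameter runs through all of `[0, ∞)`; such a geodesic is inextendible to
the future. -/
structure IsCompleteFutureNullGeodesic (S : Spacetime M) (γ : ℝ → M) : Prop where
  geodesic : IsGeodesicOn S.metric γ (Ici 0)
  null : ∀ t ∈ Ici (0 : ℝ), S.metric (γ t) (velocity γ (Ici 0) t) (velocity γ (Ici 0) t) = 0
  future : ∀ t ∈ Ici (0 : ℝ), S.metric (γ t) (velocity γ (Ici 0) t) (S.timeField (γ t)) < 0

/-- The parameters of the points of `γ` that are conjugate to its starting point `γ 0`. -/
def conjugateParams (S : Spacetime M) (γ : ℝ → M) : Set ℝ :=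
  {t | IsConjugate S.metric γ (Ici 0) 0 t}

/-- A future wandering null geodesic from `γ 0`: a complete future-directed null geodesic with an
unlimited number of conjugate points. -/
def IsFutureWandering (S : Spacetime M) (γ : ℝ → M) : Prop :=
  IsCompleteFutureNullGeodesic S γ ∧ (conjugateParams S γ).Infinite

/-- `σ`, parametrized by `[0, ∞)`, is a truncated future wandering null geodesic: what remains of a
future wandering null geodesic `γ` when the segment from its starting point to its first conjugate
point is discarded. -/
def IsTruncatedFutureWandering (S : Spacetime M) (σ : ℝ → M) : Prop :=
  ∃ (γ : ℝ → M) (t₁ : ℝ), IsFutureWandering S γ ∧ IsLeast (conjugateParams S γ) t₁ ∧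
    ∀ s ∈ Ici (0 : ℝ), σ s = γ (t₁ + s)

end

set_option maxSynthPendingDepth 3

/-! Let k be the velocity of the null geodesic. For g = Ω²η with η flat, the operator R(·, k)k acts
on the orthogonal complement of k, modulo k, as multiplication by -∇²Ω(k, k)/Ω
(`riemann_conformal_null`). A Jacobi field J orthogonal to k therefore satisfies J'' = fJ modulo k,
with a scalar f. The same equation w'' = fw is solved by w = Ω∘γ, which is positive
(`IsGeodesicOn.conformal_factor`, `IsScalarTidal`). As in Sturm comparison, V = wJ' - w'J is then
parallel modulo k, and (J/w)' = V/w² modulo k.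

Different conjugate points may come from different Jacobi fields, so three of them are compared
(`IsScalarTidal.not_three_conjugate`). Let J_i vanish at the starting point a and at τ_i, where only
the τ_i need to lie in the conformally flat stretch. The function ⟨V_i, J_j⟩/w vanishes at τ_j, and
also at τ_i because the Wronskian of J_i and J_j is zero. Its derivative is ⟨V_i, V_j⟩/w² with
constant numerator, so Rolle gives ⟨V_i, V_j⟩ = 0 for i ≠ j (`wronskian_product_eq_zero`).

The quotient of the complement of k by k has dimension two, so three pairwise orthogonal vectors V_i
cannot all be non-null (`exists_null_of_orthogonal`). If V_i is null, then so is J_i'(τ_i), which is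
thus a multiple βk (`eq_smul_of_null`). By uniqueness J_i = β(t - τ_i)k, and J_i(a) = 0 forces β =
0, hence J_i = 0, a contradiction.

All conjugate parameters are at least t₁, so a truncated wandering geodesic inside U would supply
three of them there. -/

noncomputable section

/-! ### Coordinate calculus of a pseudo-Riemannian metric -/

/-- `G` is a nondegenerate symmetric form at `y`, and smooth there. -/
structure IsMetricAt (G : E4 → E4 →L[ℝ] E4 →L[ℝ] ℝ) (y : E4) : Prop where
  smooth : ContDiffAt ℝ ∞ G y
  symm : ∀ v w, G y v w = G y w v
  invertible : (G y).IsInvertible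

/-- `christoffelLower`, as a field of continuous bilinear maps. -/
def christoffelLowerL (G : E4 → E4 →L[ℝ] E4 →L[ℝ] ℝ) (y : E4) :
    E4 →L[ℝ] E4 →L[ℝ] E4 →L[ℝ] ℝ :=
  (1 / 2 : ℝ) • (fderiv ℝ G y + (fderiv ℝ G y).flip -
    ((ContinuousLinearMap.flipₗᵢ ℝ E4 E4 ℝ).toContinuousLinearEquiv :
      (E4 →L[ℝ] E4 →L[ℝ] ℝ) →L[ℝ] (E4 →L[ℝ] E4 →L[ℝ] ℝ)).comp (fderiv ℝ G y).flip)

/-- `christoffel`, as a field of continuous bilinear maps. -/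
def christoffelL (G : E4 → E4 →L[ℝ] E4 →L[ℝ] ℝ) (y : E4) : E4 →L[ℝ] E4 →L[ℝ] E4 :=
  (ContinuousLinearMap.compL ℝ E4 (E4 →L[ℝ] ℝ) E4 (G y).inverse).comp (christoffelLowerL G y)

theorem christoffelL_apply (G : E4 → E4 →L[ℝ] E4 →L[ℝ] ℝ) (y v w : E4) :
    christoffelL G y v w = christoffel G y v w := rfl

theorem christoffelLower_apply (G : E4 → E4 →L[ℝ] E4 →L[ℝ] ℝ) (y v w z : E4) :
    christoffelLower G y v w z =
      1 / 2 * (fderiv ℝ G y v w z + fderiv ℝ G y w v z - fderiv ℝ G y z v w) := rfl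

theorem fderiv_clm_apply_field {F₁ F₂ : Type*} [NormedAddCommGroup F₁] [NormedSpace ℝ F₁]
    [NormedAddCommGroup F₂] [NormedSpace ℝ F₂] {c : E4 → F₁ →L[ℝ] F₂} {f : E4 → F₁} {y : E4}
    (hc : DifferentiableAt ℝ c y) (hf : DifferentiableAt ℝ f y) (u : E4) :
    fderiv ℝ (fun z => c z (f z)) y u = fderiv ℝ c y u (f y) + c y (fderiv ℝ f y u) := by
  rw [(hc.hasFDerivAt.clm_apply hf.hasFDerivAt).fderiv]
  simp [add_comm]

theorem fderiv_clm_apply_const {F₁ F₂ : Type*} [NormedAddCommGroup F₁] [NormedSpace ℝ F₁]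
    [NormedAddCommGroup F₂] [NormedSpace ℝ F₂] {c : E4 → F₁ →L[ℝ] F₂} {y : E4}
    (hc : DifferentiableAt ℝ c y) (v : F₁) (u : E4) :
    fderiv ℝ (fun z => c z v) y u = fderiv ℝ c y u v := by
  rw [fderiv_clm_apply_field hc (differentiableAt_const v)]
  simp

namespace IsMetricAt

variable {G : E4 → E4 →L[ℝ] E4 →L[ℝ] ℝ} {y : E4}

theorem differentiableAt (h : IsMetricAt G y) : DifferentiableAt ℝ G y :=
  h.smooth.differentiableAt (by simp)

theorem contDiffAt_fderiv (h : IsMetricAt G y) : ContDiffAt ℝ ∞ (fderiv ℝ G) y :=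
  h.smooth.fderiv_right (by simp)

theorem contDiffAt_inverse (h : IsMetricAt G y) : ContDiffAt ℝ ∞ (fun z => (G z).inverse) y :=
  h.invertible.contDiffAt_map_inverse.comp y h.smooth

theorem contDiffAt_christoffelL (h : IsMetricAt G y) : ContDiffAt ℝ ∞ (christoffelL G) y := by
  have h1 := h.contDiffAt_fderiv
  have h2 : ContDiffAt ℝ ∞ (fun z => (fderiv ℝ G z).flip) y :=
    (ContinuousLinearMap.flipₗᵢ ℝ E4 E4 (E4 →L[ℝ] ℝ)).contDiff.contDiffAt.comp y h1
  have h3 : ContDiffAt ℝ ∞ (christoffelLowerL G) y :=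
    ((h1.add h2).sub (contDiffAt_const.clm_comp h2)).const_smul _
  exact ((ContinuousLinearMap.compL ℝ E4 (E4 →L[ℝ] ℝ) E4).contDiff.contDiffAt.comp y
    h.contDiffAt_inverse).clm_comp h3

theorem differentiableAt_christoffelL (h : IsMetricAt G y) :
    DifferentiableAt ℝ (christoffelL G) y :=
  h.contDiffAt_christoffelL.differentiableAt (by simp)

theorem riemann_eq (h : IsMetricAt G y) (u v w : E4) :
    riemann G y u v w = fderiv ℝ (christoffelL G) y u v w - fderiv ℝ (christoffelL G) y v u w
      + christoffelL G y u (christoffelL G y v w) - christoffelL G y v (christoffelL G y u w) := by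
  have key : ∀ u v w, fderiv ℝ (fun z => christoffel G z v w) y u =
      fderiv ℝ (christoffelL G) y u v w := by
    intro u v w
    have := h.differentiableAt_christoffelL
    simp only [← christoffelL_apply]
    rw [fderiv_clm_apply_const (c := fun z => christoffelL G z v) (by fun_prop),
      fderiv_clm_apply_const this]
  simp only [riemann, key, christoffelL_apply]

theorem apply_inverse (h : IsMetricAt G y) (l : E4 →L[ℝ] ℝ) : G y ((G y).inverse l) = l :=
  ((h.invertible.inverse_apply_eq).1 rfl).symm

theorem apply_christoffel (h : IsMetricAt G y) (v w z : E4) :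
    G y (christoffelL G y v w) z =
      1 / 2 * (fderiv ℝ G y v w z + fderiv ℝ G y w v z - fderiv ℝ G y z v w) := by
  rw [christoffelL_apply, christoffel, h.apply_inverse, christoffelLower_apply]

theorem injective (h : IsMetricAt G y) {v w : E4} (hvw : ∀ z, G y v z = G y w z) : v = w := by
  rw [← (h.invertible.inverse_apply_eq (x := v) (y := G y v)).2 rfl,
    (h.invertible.inverse_apply_eq).2 (ContinuousLinearMap.ext hvw)]

theorem fderiv_symm (h : ∀ᶠ z in nhds y, IsMetricAt G z) (u v w : E4) :
    fderiv ℝ G y u v w = fderiv ℝ G y u w v := by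
  have hd := h.self_of_nhds.differentiableAt
  have key : ∀ v w, fderiv ℝ G y u v w = fderiv ℝ (fun z => G z v w) y u := fun v w => by
    rw [fderiv_clm_apply_const (c := fun z => G z v) (by fun_prop), fderiv_clm_apply_const hd]
  rw [key, key]
  congr 1
  exact Filter.EventuallyEq.fderiv_eq (h.mono fun z hz => hz.symm v w)

theorem christoffelL_symm (h : ∀ᶠ z in nhds y, IsMetricAt G z) (v w : E4) :
    christoffelL G y v w = christoffelL G y w v := by
  refine h.self_of_nhds.injective fun z => ?_
  rw [h.self_of_nhds.apply_christoffel, h.self_of_nhds.apply_christoffel,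
    fderiv_symm h z v w]
  ring

/-- This is ∇G = 0: in the sum of the two Koszul expressions the remaining derivatives of G cancel
in pairs. -/
theorem fderiv_eq_christoffelL (h : ∀ᶠ z in nhds y, IsMetricAt G z) (u v w : E4) :
    fderiv ℝ G y u v w = G y (christoffelL G y u v) w + G y v (christoffelL G y u w) := by
  have h0 := h.self_of_nhds
  rw [h0.symm v, h0.apply_christoffel, h0.apply_christoffel, fderiv_symm h w u v,
    fderiv_symm h v u w, fderiv_symm h u w v]
  ring

theorem fderiv_christoffelL_symm (h : ∀ᶠ z in nhds y, IsMetricAt G z) (u v w : E4) :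
    fderiv ℝ (christoffelL G) y u v w = fderiv ℝ (christoffelL G) y u w v := by
  have hd := h.self_of_nhds.differentiableAt_christoffelL
  have key : ∀ v w, fderiv ℝ (christoffelL G) y u v w =
      fderiv ℝ (fun z => christoffelL G z v w) y u := fun v w => by
    rw [fderiv_clm_apply_const (c := fun z => christoffelL G z v) (by fun_prop),
      fderiv_clm_apply_const hd]
  rw [key, key]
  congr 1
  exact Filter.EventuallyEq.fderiv_eq (h.eventually_nhds.mono fun z hz => christoffelL_symm hz v w)

theorem fderiv_fderiv_eq (h : ∀ᶠ z in nhds y, IsMetricAt G z) (u v w z : E4) :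
    fderiv ℝ (fderiv ℝ G) y u v w z =
      fderiv ℝ G y u (christoffelL G y v w) z + G y (fderiv ℝ (christoffelL G) y u v w) z
      + (fderiv ℝ G y u w (christoffelL G y v z) + G y w (fderiv ℝ (christoffelL G) y u v z)) := by
  have hG := h.self_of_nhds.differentiableAt
  have hΓ := h.self_of_nhds.differentiableAt_christoffelL
  have hd : DifferentiableAt ℝ (fderiv ℝ G) y :=
    h.self_of_nhds.contDiffAt_fderiv.differentiableAt (by simp)
  have hL : fderiv ℝ (fun x => fderiv ℝ G x v w z) y u = fderiv ℝ (fderiv ℝ G) y u v w z := by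
    rw [fderiv_clm_apply_const (c := fun x => fderiv ℝ G x v w) (by fun_prop),
      fderiv_clm_apply_const (c := fun x => fderiv ℝ G x v) (by fun_prop),
      fderiv_clm_apply_const hd]
  have hΓ' : ∀ w, fderiv ℝ (fun x => christoffelL G x v w) y u =
      fderiv ℝ (christoffelL G) y u v w := fun w => by
    rw [fderiv_clm_apply_const (c := fun x => christoffelL G x v) (by fun_prop),
      fderiv_clm_apply_const hΓ]
  have hGΓ : DifferentiableAt ℝ (fun x => G x (christoffelL G x v w)) y :=
    hG.clm_apply (by fun_prop)
  have hE : (fun x => fderiv ℝ G x v w z) =ᶠ[nhds y] fun x =>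
      G x (christoffelL G x v w) z + G x w (christoffelL G x v z) :=
    h.eventually_nhds.mono fun x hx => fderiv_eq_christoffelL hx v w z
  rw [← hL, hE.fderiv_eq, fderiv_fun_add (by fun_prop) (by fun_prop),
    _root_.add_apply,
    fderiv_clm_apply_const (c := fun x => G x (christoffelL G x v w)) (by fun_prop),
    fderiv_clm_apply_field hG (f := fun x => christoffelL G x v w) (by fun_prop),
    fderiv_clm_apply_field (c := fun x => G x w) (f := fun x => christoffelL G x v z)
      (by fun_prop) (by fun_prop),
    fderiv_clm_apply_const hG, hΓ', hΓ']
  rfl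

/-- The relation ∇G = 0 is differentiated once more and antisymmetrized in u and v. The second
derivatives of G drop out because they commute, and first derivatives are again expressed through
the Christoffel symbols. -/
theorem riemann_skew_right (h : ∀ᶠ z in nhds y, IsMetricAt G z) (u v w z : E4) :
    G y (riemann G y u v w) z = - G y (riemann G y u v z) w := by
  have h0 := h.self_of_nhds
  have hs : fderiv ℝ (fderiv ℝ G) y u v = fderiv ℝ (fderiv ℝ G) y v u :=
    (h0.smooth.isSymmSndFDerivAt (by
      rw [minSmoothness_of_isRCLikeNormedField]
      exact WithTop.coe_le_coe.2 (le_top : (2 : ℕ∞) ≤ ⊤))).eq u v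
  have hs' : fderiv ℝ (fderiv ℝ G) y u v w z = fderiv ℝ (fderiv ℝ G) y v u w z := by rw [hs]
  rw [fderiv_fderiv_eq h, fderiv_fderiv_eq h] at hs'
  simp only [fderiv_eq_christoffelL h] at hs'
  rw [h0.riemann_eq, h0.riemann_eq]
  simp only [map_add, map_sub, _root_.add_apply, _root_.sub_apply]
  rw [h0.symm w, h0.symm w, h0.symm w, h0.symm w] at hs'
  linarith

theorem riemann_skew_left (h : IsMetricAt G y) (u v w : E4) :
    riemann G y u v w = - riemann G y v u w := by
  rw [h.riemann_eq, h.riemann_eq]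
  abel

theorem riemann_bianchi (h : ∀ᶠ z in nhds y, IsMetricAt G z) (u v w : E4) :
    riemann G y u v w + riemann G y v w u + riemann G y w u v = 0 := by
  have h0 := h.self_of_nhds
  rw [h0.riemann_eq, h0.riemann_eq, h0.riemann_eq, fderiv_christoffelL_symm h u v w,
    fderiv_christoffelL_symm h v w u, fderiv_christoffelL_symm h w u v,
    christoffelL_symm h v w, christoffelL_symm h w u, christoffelL_symm h u v]
  abel

theorem riemann_pair_symm (h : ∀ᶠ z in nhds y, IsMetricAt G z) (u v w z : E4) :
    G y (riemann G y u v w) z = G y (riemann G y w z u) v := by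
  have h0 := h.self_of_nhds
  have A : ∀ u v w z, G y (riemann G y u v w) z = - G y (riemann G y v u w) z := by
    intro u v w z
    rw [h0.riemann_skew_left u v w]; simp
  have B := fun u v w z => riemann_skew_right h u v w z
  have C : ∀ u v w z, G y (riemann G y u v w) z + G y (riemann G y v w u) z
      + G y (riemann G y w u v) z = 0 := by
    intro u v w z
    have := congrArg (fun x => G y x z) (riemann_bianchi h u v w)
    simpa using this
  -- The octahedron argument: in a combination of the four cyclic identities, the two skew
  -- symmetries cancel all terms but the two wanted.
  linarith [C u v w z, C v w z u, C w z u v, C z u v w, A u v w z, B u v w z, A v w u z,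
    B v w u z, A w u v z, B w u v z, A v w z u, B v w z u, A w z v u, B w z v u, A z v w u,
    B z v w u, A w z u v, B w z u v, A z u w v, B z u w v, A u w z v, B u w z v, A z u v w,
    B z u v w, A u v z w, B u v z w, A v z u w, B v z u w]

end IsMetricAt

/-! ### Curvature of a conformally flat metric in null directions -/

section Conformal

variable {F : E4 → ℝ} {G H : E4 → E4 →L[ℝ] E4 →L[ℝ] ℝ} {y : E4}

/-- The logarithmic differential of a function. -/
def logDiff (F : E4 → ℝ) (y : E4) : E4 →L[ℝ] ℝ := (F y)⁻¹ • fderiv ℝ F y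

theorem fderiv_conformal (hF : DifferentiableAt ℝ F y) (hH : DifferentiableAt ℝ H y)
    (hGH : G =ᶠ[nhds y] fun z => F z ^ 2 • H z) (u v w : E4) :
    fderiv ℝ G y u v w = 2 * F y * fderiv ℝ F y u * H y v w + F y ^ 2 * fderiv ℝ H y u v w := by
  rw [hGH.fderiv_eq, fderiv_fun_smul (by fun_prop) hH, fderiv_fun_pow 2 hF]
  simp
  ring

/-- By nondegeneracy it suffices to compare after lowering the index with G, where both sides are
explicit in the first derivatives of F and H. -/
theorem christoffelL_conformal (hF : DifferentiableAt ℝ F y) (hF0 : F y ≠ 0)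
    (hH : IsMetricAt H y) (hG : IsMetricAt G y) (hGH : G =ᶠ[nhds y] fun z => F z ^ 2 • H z)
    (v w : E4) :
    christoffelL G y v w = christoffelL H y v w + logDiff F y v • w + logDiff F y w • v
      - H y v w • (H y).inverse (logDiff F y) := by
  refine hG.injective fun z => ?_
  rw [hG.apply_christoffel]
  simp only [fderiv_conformal hF hH.differentiableAt hGH, hGH.self_of_nhds, map_add, map_sub,
    map_smul, _root_.add_apply, _root_.sub_apply, _root_.smul_apply, hH.apply_inverse,
    hH.apply_christoffel, logDiff, smul_eq_mul]
  field_simp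
  ring

theorem fderiv_christoffelL_conformal (hF : ∀ᶠ z in nhds y, ContDiffAt ℝ ∞ F z ∧ F z ≠ 0)
    (hH : ∀ᶠ z in nhds y, IsMetricAt H z) (hG : ∀ᶠ z in nhds y, IsMetricAt G z)
    (hGH : G =ᶠ[nhds y] fun z => F z ^ 2 • H z) (u v w : E4) :
    fderiv ℝ (christoffelL G) y u v w =
      fderiv ℝ (christoffelL H) y u v w + fderiv ℝ (logDiff F) y u v • w
        + fderiv ℝ (logDiff F) y u w • v
        - (fderiv ℝ H y u v w • (H y).inverse (logDiff F y)
          + H y v w • fderiv ℝ (fun z => (H z).inverse (logDiff F z)) y u) := by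
  have hdG := hG.self_of_nhds.differentiableAt_christoffelL
  have hdH := hH.self_of_nhds.differentiableAt_christoffelL
  have hH0 := hH.self_of_nhds.differentiableAt
  have hF1 := hF.self_of_nhds.1
  have ha : DifferentiableAt ℝ (logDiff F) y :=
    (hF1.differentiableAt (by simp)).inv hF.self_of_nhds.2 |>.smul
      ((hF1.fderiv_right (m := ∞) (by simp)).differentiableAt (by simp))
  have hA : DifferentiableAt ℝ (fun z => (H z).inverse (logDiff F z)) y :=
    (hH.self_of_nhds.contDiffAt_inverse.differentiableAt (by simp)).clm_apply ha
  have hE : (fun z => christoffelL G z v w) =ᶠ[nhds y] fun z =>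
      christoffelL H z v w + logDiff F z v • w + logDiff F z w • v
        - H z v w • (H z).inverse (logDiff F z) := by
    filter_upwards [hF, hH, hG, hGH.eventually_nhds] with z h1 h2 h3 h4
    exact christoffelL_conformal (h1.1.differentiableAt (by simp)) h1.2 h2 h3 h4 v w
  have key : ∀ {K : E4 → E4 →L[ℝ] E4 →L[ℝ] E4}, DifferentiableAt ℝ K y →
      fderiv ℝ (fun z => K z v w) y u = fderiv ℝ K y u v w := fun {K} hK => by
    rw [fderiv_clm_apply_const (c := fun z => K z v) (by fun_prop), fderiv_clm_apply_const hK]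
  have keyH : fderiv ℝ (fun z => H z v w) y u = fderiv ℝ H y u v w := by
    rw [fderiv_clm_apply_const (c := fun z => H z v) (by fun_prop), fderiv_clm_apply_const hH0]
  rw [← key hdG, hE.fderiv_eq, fderiv_fun_sub (by fun_prop) (by fun_prop),
    fderiv_fun_add (by fun_prop) (by fun_prop), fderiv_fun_add (by fun_prop) (by fun_prop),
    fderiv_fun_smul (by fun_prop) hA, fderiv_smul_const (by fun_prop),
    fderiv_smul_const (by fun_prop)]
  simp only [_root_.add_apply, _root_.sub_apply, _root_.smul_apply,
    ContinuousLinearMap.smulRight_apply, key hdH, keyH, fderiv_clm_apply_const ha]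
  abel

theorem fderiv_logDiff (hF : ContDiffAt ℝ ∞ F y) (hF0 : F y ≠ 0) (u v : E4) :
    fderiv ℝ (logDiff F) y u v =
      (F y)⁻¹ * fderiv ℝ (fderiv ℝ F) y u v - logDiff F y u * logDiff F y v := by
  have h1 : DifferentiableAt ℝ F y := hF.differentiableAt (by simp)
  have h2 : DifferentiableAt ℝ (fderiv ℝ F) y :=
    (hF.fderiv_right (m := ∞) (by simp)).differentiableAt (by simp)
  have : HasFDerivAt (logDiff F) _ y := 
    ((hasDerivAt_inv hF0).comp_hasFDerivAt y h1.hasFDerivAt).smul h2.hasFDerivAt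
  rw [this.fderiv]
  simp [logDiff]
  field_simp
  ring

/-- For a metric `F² H` with `H` flat, the tidal operator `R(·, k) k` of a null vector `k` is on the
orthogonal complement of `k`, modulo `k`, the multiplication with `- ∇²F(k, k) / F`. -/
theorem riemann_conformal_null (hF : ∀ᶠ z in nhds y, ContDiffAt ℝ ∞ F z ∧ F z ≠ 0)
    (hH : ∀ᶠ z in nhds y, IsMetricAt H z) (hG : ∀ᶠ z in nhds y, IsMetricAt G z)
    (hGH : G =ᶠ[nhds y] fun z => F z ^ 2 • H z) (hflat : ∀ u v w, riemann H y u v w = 0)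
    {k v : E4} (hk : G y k k = 0) (hv : G y v k = 0) :
    ∃ β : ℝ, F y • riemann G y v k k =
      - (fderiv ℝ (fderiv ℝ F) y k k - fderiv ℝ F y (christoffelL G y k k)) • v + β • k := by
  have hF0 := hF.self_of_nhds.2
  have hFd : DifferentiableAt ℝ F y := hF.self_of_nhds.1.differentiableAt (by simp)
  have hkH : H y k k = 0 := by
    have := hGH.self_of_nhds; rw [this] at hk; simpa [hF0] using hk
  have hvH : H y v k = 0 := by
    have := hGH.self_of_nhds; rw [this] at hv; simpa [hF0] using hv
  have hkvH : H y k v = 0 := by rw [hH.self_of_nhds.symm, hvH]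
  have hR := hflat v k k
  rw [hH.self_of_nhds.riemann_eq] at hR
  have hc := fun v w => christoffelL_conformal hFd hF0 hH.self_of_nhds hG.self_of_nhds hGH v w
  -- The coefficient with which the gradient of log F enters the curvature; metric compatibility of
  -- H makes it vanish.
  have hA : -fderiv ℝ H y v k k + fderiv ℝ H y k v k - H y v (christoffelL H y k k)
      + H y k (christoffelL H y v k) = 0 := by
    rw [IsMetricAt.fderiv_eq_christoffelL hH, IsMetricAt.fderiv_eq_christoffelL hH,
      hH.self_of_nhds.symm (christoffelL H y v k) k, hH.self_of_nhds.symm (christoffelL H y k v) k,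
      IsMetricAt.christoffelL_symm hH v k]
    ring
  have hΓ : fderiv ℝ F y = F y • logDiff F y := by
    rw [logDiff, smul_smul, mul_inv_cancel₀ hF0, one_smul]
  -- β collects all terms of F R(v, k)k proportional to k.
  refine ⟨F y * (2 * fderiv ℝ (logDiff F) y v k - fderiv ℝ (logDiff F) y k v
    - logDiff F y k * logDiff F y v - logDiff F y (christoffelL H y v k)), ?_⟩
  have hd : fderiv ℝ (fderiv ℝ F) y k k =
      F y * (fderiv ℝ (logDiff F) y k k + logDiff F y k * logDiff F y k) := by
    rw [fderiv_logDiff hF.self_of_nhds.1 hF0]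
    field_simp
    ring
  rw [hd, hG.self_of_nhds.riemann_eq]
  simp only [fderiv_christoffelL_conformal hF hH hG hGH, hc, hkH, hvH, zero_smul, map_add,
    map_smul, sub_zero, add_zero, _root_.smul_apply, hΓ, smul_eq_mul]
  -- The difference of the two sides is F times the curvature of H, plus a multiple of the gradient
  -- of log F with coefficient `hA`. Both are zero.
  have hS := congrArg (fun x => F y • x) hR
  have hT := congrArg (fun c : ℝ => (F y * c) • (H y).inverse (logDiff F y)) hA
  simp only [smul_zero, mul_zero, zero_smul] at hS hT
  rw [← sub_eq_zero]
  rw [← add_zero (0 : E4)]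
  nth_rewrite 1 [← hS]
  rw [← hT]
  rw [IsMetricAt.christoffelL_symm hH k v]
  simp only [hkvH, mul_zero]
  module

end Conformal

/-! ### Fields of forms in charts -/

section Chart

variable {M : Type*} [TopologicalSpace M] [ChartedSpace E4 M]
  {φ : OpenPartialHomeomorph M E4} {h : FormField M} {U : Set M}

theorem IsLorentzianOn.eq_zero (hL : IsLorentzianOn h U) {x : M} (hx : x ∈ U)
    {v : TangentSpace 𝓘(ℝ, E4) x} (hv : ∀ w, h x v w = 0) : v = 0 := by
  obtain ⟨e, he⟩ := hL.signature x hx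
  rw [← e.sum_repr v] at hv ⊢
  refine Finset.sum_eq_zero fun i _ => ?_
  have := hv (e i)
  rw [map_sum, _root_.sum_apply] at this
  simp only [map_smul, _root_.smul_apply, he, smul_eq_mul] at this
  rw [Finset.sum_eq_single i (by intro b _ hb; simp [hb]) (by simp)] at this
  have h0 : e.repr v i = 0 := by
    by_cases hi : i = 0 <;> simpa [hi] using this
  rw [h0, zero_smul]

variable [IsManifold 𝓘(ℝ, E4) ∞ M]

theorem toChart_symm_apply (hφ : φ ∈ atlas E4 M) {x : M} (hx : x ∈ φ.source)
    (v : TangentSpace 𝓘(ℝ, E4) x) :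
    (mfderiv 𝓘(ℝ, E4) 𝓘(ℝ, E4) φ.symm (φ x) (toChart φ x v) : E4) = v :=
  congrArg (fun L : E4 →L[ℝ] E4 => L v)
    ((mdifferentiable_of_mem_atlas (I := 𝓘(ℝ, E4)) hφ).symm_comp_deriv hx)

theorem toChart_injective (hφ : φ ∈ atlas E4 M) {x : M} (hx : x ∈ φ.source)
    {v w : TangentSpace 𝓘(ℝ, E4) x} (hvw : toChart φ x v = toChart φ x w) : v = w := by
  have h1 := toChart_symm_apply hφ hx v
  rw [hvw] at h1
  exact h1.symm.trans (toChart_symm_apply hφ hx w)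

theorem coordForm_toChart (h : FormField M) (hφ : φ ∈ atlas E4 M) {x : M} (hx : x ∈ φ.source)
    (v w : TangentSpace 𝓘(ℝ, E4) x) :
    coordForm h φ (φ x) (toChart φ x v) (toChart φ x w) = h x v w := by
  -- The points `φ.symm (φ x)` and `x` are only propositionally equal, so the forms at them are
  -- compared with both tangent spaces read as `E4`.
  have key : ∀ x' : M, x' = x → ∀ a b : E4,
      (h x' : E4 →L[ℝ] E4 →L[ℝ] ℝ) a b = (h x : E4 →L[ℝ] E4 →L[ℝ] ℝ) a b := by
    rintro x' rfl a b; rfl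
  have h1 := key _ (φ.left_inv hx) (mfderiv 𝓘(ℝ, E4) 𝓘(ℝ, E4) φ.symm (φ x) (toChart φ x v))
    (mfderiv 𝓘(ℝ, E4) 𝓘(ℝ, E4) φ.symm (φ x) (toChart φ x w))
  refine Eq.trans h1 ?_
  rw [toChart_symm_apply hφ hx, toChart_symm_apply hφ hx]

theorem isInvertible_of_injective {B : E4 →L[ℝ] E4 →L[ℝ] ℝ} (hB : Function.Injective B) :
    B.IsInvertible := by
  have hfin : Module.finrank ℝ E4 = Module.finrank ℝ (E4 →L[ℝ] ℝ) := by
    rw [← (LinearMap.toContinuousLinearMap (𝕜 := ℝ) (E := E4) (F' := ℝ)).finrank_eq]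
    exact (Subspace.dual_finrank_eq).symm
  have : FiniteDimensional ℝ (E4 →L[ℝ] ℝ) :=
    (LinearMap.toContinuousLinearMap (𝕜 := ℝ) (E := E4) (F' := ℝ)).finiteDimensional
  refine ⟨(LinearEquiv.ofInjectiveOfFinrankEq (B : E4 →ₗ[ℝ] (E4 →L[ℝ] ℝ)) hB
    hfin).toContinuousLinearEquiv, ?_⟩
  ext v w
  rfl

theorem IsLorentzianOn.isMetricAt (hL : IsLorentzianOn h U) (hU : IsOpen U)
    (hφ : φ ∈ atlas E4 M) {y : E4} (hy : y ∈ φ.target) (hyU : φ.symm y ∈ U) :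
    IsMetricAt (coordForm h φ) y := by
  refine ⟨(hL.smooth φ hφ).contDiffAt
    ((φ.symm.isOpen_inter_preimage hU).mem_nhds ⟨hy, hyU⟩), fun v w => hL.symm _ hyU _ _, ?_⟩
  refine isInvertible_of_injective ?_
  rw [injective_iff_map_eq_zero]
  intro v hv
  have hs := (mdifferentiable_of_mem_atlas (I := 𝓘(ℝ, E4)) hφ).comp_symm_deriv hy
  have hs' : ∀ w : E4, mfderiv 𝓘(ℝ, E4) 𝓘(ℝ, E4) φ (φ.symm y)
      (mfderiv 𝓘(ℝ, E4) 𝓘(ℝ, E4) φ.symm y w) = w :=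
    fun w => congrArg (fun L : E4 →L[ℝ] E4 => L w) hs
  have hs2 := (mdifferentiable_of_mem_atlas (I := 𝓘(ℝ, E4)) hφ).symm_comp_deriv
    (φ.map_target hy)
  rw [φ.right_inv hy] at hs2
  have h0 : (mfderiv 𝓘(ℝ, E4) 𝓘(ℝ, E4) φ.symm y v) = 0 := by
    refine hL.eq_zero hyU fun w => ?_
    have hw : mfderiv 𝓘(ℝ, E4) 𝓘(ℝ, E4) φ.symm y
        (mfderiv 𝓘(ℝ, E4) 𝓘(ℝ, E4) φ (φ.symm y) w) = w :=
      congrArg (fun L : E4 →L[ℝ] E4 => L w) hs2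
    rw [← hw]
    exact congrArg (fun l : E4 →L[ℝ] ℝ => l (mfderiv 𝓘(ℝ, E4) 𝓘(ℝ, E4) φ (φ.symm y) w)) hv
  rw [← hs' v, h0]
  exact map_zero (mfderiv 𝓘(ℝ, E4) 𝓘(ℝ, E4) φ (φ.symm y))

theorem IsLorentzianOn.eventually_isMetricAt (hL : IsLorentzianOn h U) (hU : IsOpen U)
    (hφ : φ ∈ atlas E4 M) {x : M} (hx : x ∈ φ.source) (hxU : x ∈ U) :
    ∀ᶠ z in nhds (φ x), IsMetricAt (coordForm h φ) z := by
  have : φ.target ∩ φ.symm ⁻¹' U ∈ nhds (φ x) :=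
    (φ.symm.isOpen_inter_preimage hU).mem_nhds
      ⟨φ.map_source hx, by simpa [φ.left_inv hx] using hxU⟩
  filter_upwards [this] with z hz
  exact hL.isMetricAt hU hφ hz.1 hz.2

end Chart

/-! ### Fields along a curve -/

section Along

variable {M : Type*} [TopologicalSpace M] [ChartedSpace E4 M]
  {φ : OpenPartialHomeomorph M E4} {h : FormField M} {U : Set M} {γ : ℝ → M} {I : Set ℝ} {t : ℝ}

theorem eventually_mem_source (hγ : ContMDiffOn 𝓘(ℝ, ℝ) 𝓘(ℝ, E4) ∞ γ I) (ht : t ∈ I) {V : Set M}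
    (hV : IsOpen V) (hx : γ t ∈ V) : ∀ᶠ s in nhdsWithin t I, γ s ∈ V :=
  (hγ.continuousOn t ht).eventually (hV.mem_nhds hx)

variable [IsManifold 𝓘(ℝ, E4) ∞ M]

theorem hasDerivWithinAt_chart (hγ : ContMDiffOn 𝓘(ℝ, ℝ) 𝓘(ℝ, E4) ∞ γ I)
    (hφ : φ ∈ atlas E4 M) (ht : t ∈ I) (hx : γ t ∈ φ.source) :
    HasDerivWithinAt (fun s => φ (γ s)) (toChart φ (γ t) (velocity γ I t)) I t := by
  have h1 := ((hγ t ht).mdifferentiableWithinAt (by simp)).hasMFDerivWithinAt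
  have h2 := (mdifferentiableAt_atlas (I := 𝓘(ℝ, E4)) hφ hx).hasMFDerivAt
  let A : ℝ →L[ℝ] E4 := (mfderiv 𝓘(ℝ, E4) 𝓘(ℝ, E4) φ (γ t)).comp
    (mfderivWithin 𝓘(ℝ, ℝ) 𝓘(ℝ, E4) γ I t)
  have h3 : HasFDerivWithinAt (fun s => φ (γ s)) A I t :=
    (h2.comp_hasMFDerivWithinAt t h1).hasFDerivWithinAt
  have h4 : HasDerivWithinAt (fun s => φ (γ s)) (A 1) I t := h3.hasDerivWithinAt
  exact h4

/-- The Leibniz rule in a chart: since ∇h = 0, the derivative of the coefficients of h absorbs the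
Christoffel terms. -/
theorem hasDerivWithinAt_metric (hL : IsLorentzianOn h univ)
    (hγ : ContMDiffOn 𝓘(ℝ, ℝ) 𝓘(ℝ, E4) ∞ γ I) {V W V' W' : ∀ t, TangentSpace 𝓘(ℝ, E4) (γ t)}
    (hV : IsCovariantDerivAlong h γ I V V') (hW : IsCovariantDerivAlong h γ I W W') (ht : t ∈ I) :
    HasDerivWithinAt (fun s => h (γ s) (V s) (W s))
      (h (γ t) (V' t) (W t) + h (γ t) (V t) (W' t)) I t := by
  set φ := chartAt E4 (γ t)
  have hφ : φ ∈ atlas E4 M := chart_mem_atlas E4 (γ t)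
  have hx : γ t ∈ φ.source := mem_chart_source E4 (γ t)
  have hG := hL.eventually_isMetricAt isOpen_univ hφ hx (mem_univ _)
  have hc := hasDerivWithinAt_chart hγ hφ ht hx
  have h1 := hG.self_of_nhds.differentiableAt.hasFDerivAt.comp_hasDerivWithinAt t hc
  have h2 := (h1.clm_apply (hV φ hφ t ht hx)).clm_apply (hW φ hφ t ht hx)
  have hE : (fun s => h (γ s) (V s) (W s)) =ᶠ[nhdsWithin t I] fun s =>
      coordForm h φ (φ (γ s)) (toChart φ (γ s) (V s)) (toChart φ (γ s) (W s)) :=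
    (eventually_mem_source hγ ht φ.open_source hx).mono fun s hs =>
      (coordForm_toChart h hφ hs _ _).symm
  refine (h2.congr_of_eventuallyEq hE (coordForm_toChart h hφ hx _ _).symm).congr_deriv ?_
  rw [← coordForm_toChart h hφ hx, ← coordForm_toChart h hφ hx]
  simp only [Function.comp, _root_.add_apply, ContinuousLinearMap.map_sub, _root_.sub_apply]
  rw [IsMetricAt.fderiv_eq_christoffelL hG, christoffelL_apply, christoffelL_apply]
  ring

/-- `J` is a Jacobi field along `γ` with first and second covariant derivatives `DJ` and `DDJ`. -/
structure IsJacobiWith (h : FormField M) (γ : ℝ → M) (I : Set ℝ)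
    (J DJ DDJ : ∀ t, TangentSpace 𝓘(ℝ, E4) (γ t)) : Prop where
  fst : IsCovariantDerivAlong h γ I J DJ
  snd : IsCovariantDerivAlong h γ I DJ DDJ
  eqn : ∀ φ ∈ atlas E4 M, ∀ t ∈ I, γ t ∈ φ.source →
    toChart φ (γ t) (DDJ t) =
      - riemann (coordForm h φ) (φ (γ t)) (toChart φ (γ t) (J t))
          (toChart φ (γ t) (velocity γ I t)) (toChart φ (γ t) (velocity γ I t))

variable {J DJ DDJ K DK DDK : ∀ t, TangentSpace 𝓘(ℝ, E4) (γ t)}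

/-- The pair symmetry of the curvature makes the tidal operator self-adjoint, so Wronskians of
Jacobi fields are conserved. -/
theorem IsJacobiWith.metric_symm (hL : IsLorentzianOn h univ) (hJ : IsJacobiWith h γ I J DJ DDJ)
    (hK : IsJacobiWith h γ I K DK DDK) (ht : t ∈ I) :
    h (γ t) (DDJ t) (K t) = h (γ t) (J t) (DDK t) := by
  set φ := chartAt E4 (γ t)
  have hφ : φ ∈ atlas E4 M := chart_mem_atlas E4 (γ t)
  have hx : γ t ∈ φ.source := mem_chart_source E4 (γ t)
  have hG := hL.eventually_isMetricAt isOpen_univ hφ hx (mem_univ _)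
  rw [← coordForm_toChart h hφ hx, ← coordForm_toChart h hφ hx, hJ.eqn φ hφ t ht hx,
    hK.eqn φ hφ t ht hx, hG.self_of_nhds.symm (toChart φ (γ t) (J t))]
  simp only [map_neg, _root_.neg_apply]
  rw [IsMetricAt.riemann_pair_symm hG, hG.self_of_nhds.riemann_skew_left, map_neg,
    _root_.neg_apply, IsMetricAt.riemann_skew_right hG, neg_neg]

theorem IsJacobiWith.metric_velocity (hL : IsLorentzianOn h univ)
    (hJ : IsJacobiWith h γ I J DJ DDJ) (ht : t ∈ I) :
    h (γ t) (DDJ t) (velocity γ I t) = 0 := by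
  set φ := chartAt E4 (γ t)
  have hφ : φ ∈ atlas E4 M := chart_mem_atlas E4 (γ t)
  have hx : γ t ∈ φ.source := mem_chart_source E4 (γ t)
  have hG := hL.eventually_isMetricAt isOpen_univ hφ hx (mem_univ _)
  rw [← coordForm_toChart h hφ hx, hJ.eqn φ hφ t ht hx]
  simp only [map_neg, _root_.neg_apply]
  have := IsMetricAt.riemann_skew_right hG (toChart φ (γ t) (J t))
    (toChart φ (γ t) (velocity γ I t)) (toChart φ (γ t) (velocity γ I t))
    (toChart φ (γ t) (velocity γ I t))
  linarith

end Along

/-! ### The conformal factor along a null geodesic -/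

theorem hasDerivWithinAt_clm_apply_comp {α : E4 → E4 →L[ℝ] ℝ} {c k : ℝ → E4} {c' k' : E4}
    {I : Set ℝ} {t : ℝ} (hα : DifferentiableAt ℝ α (c t)) (hc : HasDerivWithinAt c c' I t)
    (hk : HasDerivWithinAt k k' I t) :
    HasDerivWithinAt (fun s => α (c s) (k s)) (fderiv ℝ α (c t) c' (k t) + α (c t) k') I t :=
  (hα.hasFDerivAt.comp_hasDerivWithinAt t hc).clm_apply hk

theorem target_inter_preimage_mem_nhds {M : Type*} [TopologicalSpace M]
    (φ : OpenPartialHomeomorph M E4) {U : Set M} (hU : IsOpen U) {x : M}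
    (hx : x ∈ φ.source) (hxU : x ∈ U) : φ.target ∩ φ.symm ⁻¹' U ∈ nhds (φ x) :=
  (φ.symm.isOpen_inter_preimage hU).mem_nhds
    ⟨φ.map_source hx, by simpa [φ.left_inv hx] using hxU⟩

section ConformalAlong

variable {M : Type*} [TopologicalSpace M] [ChartedSpace E4 M]
  {h : FormField M} {U : Set M} {γ : ℝ → M} {I : Set ℝ} {t : ℝ}

theorem coordForm_conformal (φ : OpenPartialHomeomorph M E4) (hU : IsOpen U) {Ω : M → ℝ}
    {η : FormField M} (hc : ∀ x ∈ U, h x = (Ω x) ^ 2 • η x) {x : M} (hx : x ∈ φ.source)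
    (hxU : x ∈ U) :
    coordForm h φ =ᶠ[nhds (φ x)] fun z => Ω (φ.symm z) ^ 2 • coordForm η φ z := by
  filter_upwards [target_inter_preimage_mem_nhds φ hU hx hxU] with z hz
  rw [coordForm, coordForm, hc _ hz.2]
  rfl

theorem IsGeodesicOn.hasDerivWithinAt_velocity {φ : OpenPartialHomeomorph M E4}
    (hγ : IsGeodesicOn h γ I) (hφ : φ ∈ atlas E4 M) (ht : t ∈ I) (hx : γ t ∈ φ.source) :
    HasDerivWithinAt (fun s => toChart φ (γ s) (velocity γ I s))
      (-christoffelL (coordForm h φ) (φ (γ t)) (toChart φ (γ t) (velocity γ I t))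
        (toChart φ (γ t) (velocity γ I t))) I t := by
  have h0 : toChart φ (γ t) (0 : TangentSpace 𝓘(ℝ, E4) (γ t)) = 0 :=
    map_zero (mfderiv 𝓘(ℝ, E4) 𝓘(ℝ, E4) φ (γ t))
  refine (hγ.2 φ hφ t ht hx).congr_deriv ?_
  rw [h0, zero_sub, christoffelL_apply]

variable [IsManifold 𝓘(ℝ, E4) ∞ M]

theorem eventually_contDiffAt_comp_symm {φ : OpenPartialHomeomorph M E4} (hφ : φ ∈ atlas E4 M)
    (hU : IsOpen U) {Ω : M → ℝ} (hΩ : ContMDiffOn 𝓘(ℝ, E4) 𝓘(ℝ, ℝ) ∞ Ω U)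
    (hΩ0 : ∀ x ∈ U, 0 < Ω x) {x : M} (hx : x ∈ φ.source) (hxU : x ∈ U) :
    ∀ᶠ z in nhds (φ x), ContDiffAt ℝ ∞ (fun y => Ω (φ.symm y)) z ∧ Ω (φ.symm z) ≠ 0 := by
  filter_upwards [target_inter_preimage_mem_nhds φ hU hx hxU] with z hz
  refine ⟨?_, (hΩ0 _ hz.2).ne'⟩
  have h1 : ContMDiffAt 𝓘(ℝ, E4) 𝓘(ℝ, E4) ∞ φ.symm z :=
    (contMDiffOn_symm_of_mem_maximalAtlas
      (IsManifold.subset_maximalAtlas hφ)).contMDiffAt (φ.open_target.mem_nhds hz.1)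
  have h2 : ContMDiffAt 𝓘(ℝ, E4) 𝓘(ℝ, ℝ) ∞ Ω (φ.symm z) :=
    hΩ.contMDiffAt (hU.mem_nhds hz.2)
  exact (h2.comp z h1).contDiffAt

theorem hasDerivWithinAt_comp_chart {φ : OpenPartialHomeomorph M E4} (hφ : φ ∈ atlas E4 M)
    (hγ : ContMDiffOn 𝓘(ℝ, ℝ) 𝓘(ℝ, E4) ∞ γ I) {Ω : M → ℝ} (ht : t ∈ I) (hx : γ t ∈ φ.source)
    (hd : DifferentiableAt ℝ (fun y => Ω (φ.symm y)) (φ (γ t))) :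
    HasDerivWithinAt (fun s => Ω (γ s)) (fderiv ℝ (fun y => Ω (φ.symm y)) (φ (γ t))
      (toChart φ (γ t) (velocity γ I t))) I t := by
  have hFx : ∀ {x : M}, x ∈ φ.source → Ω x = Ω (φ.symm (φ x)) := fun hx => by
    rw [φ.left_inv hx]
  have h1 := hd.hasFDerivAt.comp_hasDerivWithinAt t (hasDerivWithinAt_chart hγ hφ ht hx)
  refine h1.congr_of_eventuallyEq ?_ (hFx hx)
  exact (eventually_mem_source hγ ht φ.open_source hx).mono fun r hr => hFx hr

/-- Since γ'' = -Γ(γ', γ') in a chart, the second derivative of Ω∘γ is the covariant Hessian of Ω on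
the velocity, the quantity that appears in `riemann_conformal_null`. -/
theorem hasDerivWithinAt_derivWithin_comp_chart {φ : OpenPartialHomeomorph M E4}
    (hφ : φ ∈ atlas E4 M) (hI : UniqueDiffOn ℝ I) (hγ : IsGeodesicOn h γ I) {Ω : M → ℝ}
    (ht : t ∈ I) (hx : γ t ∈ φ.source)
    (hd : ContDiffAt ℝ ∞ (fun y => Ω (φ.symm y)) (φ (γ t))) :
    HasDerivWithinAt (derivWithin (fun s => Ω (γ s)) I)
      (fderiv ℝ (fderiv ℝ (fun y => Ω (φ.symm y))) (φ (γ t))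
          (toChart φ (γ t) (velocity γ I t)) (toChart φ (γ t) (velocity γ I t))
        - fderiv ℝ (fun y => Ω (φ.symm y)) (φ (γ t)) (christoffelL (coordForm h φ) (φ (γ t))
          (toChart φ (γ t) (velocity γ I t)) (toChart φ (γ t) (velocity γ I t)))) I t := by
  have hcont : ContinuousWithinAt (fun s => φ (γ s)) I t :=
    (hasDerivWithinAt_chart hγ.1 hφ ht hx).continuousWithinAt
  have hd' : ∀ᶠ z in nhds (φ (γ t)), DifferentiableAt ℝ (fun y => Ω (φ.symm y)) z :=
    ((hd.of_le (m := 1) (by simp)).eventually (by simp)).mono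
      fun z hz => hz.differentiableAt (by simp)
  have hE : derivWithin (fun s => Ω (γ s)) I =ᶠ[nhdsWithin t I] fun s =>
      fderiv ℝ (fun y => Ω (φ.symm y)) (φ (γ s)) (toChart φ (γ s) (velocity γ I s)) := by
    filter_upwards [eventually_mem_source hγ.1 ht φ.open_source hx, hcont.eventually hd',
      self_mem_nhdsWithin] with s h1 h2 h3
    exact (hasDerivWithinAt_comp_chart hφ hγ.1 h3 h1 h2).derivWithin (hI s h3)
  have hF2 : DifferentiableAt ℝ (fderiv ℝ (fun y => Ω (φ.symm y))) (φ (γ t)) :=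
    (hd.fderiv_right (m := ∞) (by simp)).differentiableAt (by simp)
  have h2 := hasDerivWithinAt_clm_apply_comp hF2 (hasDerivWithinAt_chart hγ.1 hφ ht hx)
    (hγ.hasDerivWithinAt_velocity hφ ht hx)
  refine (h2.congr_of_eventuallyEq hE (hE.self_of_nhdsWithin ht)).congr_deriv ?_
  rw [map_neg, ← sub_eq_add_neg]

/-- Along a null geodesic of `h = Ω² η` with `η` flat, `Ω` satisfies the same scalar equation
as the components of the Jacobi fields orthogonal to the geodesic. -/
theorem IsGeodesicOn.conformal_factor (hL : IsLorentzianOn h univ) (hI : UniqueDiffOn ℝ I)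
    (hγ : IsGeodesicOn h γ I) (hU : IsOpen U) {Ω : M → ℝ} {η : FormField M}
    (hΩ : ContMDiffOn 𝓘(ℝ, E4) 𝓘(ℝ, ℝ) ∞ Ω U) (hΩ0 : ∀ x ∈ U, 0 < Ω x)
    (hη : IsLorentzianOn η U) (hflat : IsFlatOn η U) (hc : ∀ x ∈ U, h x = (Ω x) ^ 2 • η x)
    (ht : t ∈ I) (htU : γ t ∈ U)
    (hnull : h (γ t) (velocity γ I t) (velocity γ I t) = 0) :
    ∃ w₂ : ℝ, HasDerivWithinAt (fun s => Ω (γ s)) (derivWithin (fun s => Ω (γ s)) I t) I t ∧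
      HasDerivWithinAt (derivWithin (fun s => Ω (γ s)) I) w₂ I t ∧
      ∀ {J DJ DDJ : ∀ t, TangentSpace 𝓘(ℝ, E4) (γ t)}, IsJacobiWith h γ I J DJ DDJ →
        h (γ t) (J t) (velocity γ I t) = 0 → ∀ Y : TangentSpace 𝓘(ℝ, E4) (γ t),
        h (γ t) (velocity γ I t) Y = 0 →
        Ω (γ t) * h (γ t) (DDJ t) Y = w₂ * h (γ t) (J t) Y := by
  obtain ⟨φ, hφ, hx⟩ : ∃ φ ∈ atlas E4 M, γ t ∈ φ.source :=
    ⟨chartAt E4 (γ t), chart_mem_atlas E4 (γ t), mem_chart_source E4 (γ t)⟩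
  have hG := hL.eventually_isMetricAt isOpen_univ hφ hx (mem_univ _)
  have hH := hη.eventually_isMetricAt hU hφ hx htU
  have hF := eventually_contDiffAt_comp_symm hφ hU hΩ hΩ0 hx htU
  have hF1 := hF.self_of_nhds.1
  have hw1 := hasDerivWithinAt_comp_chart hφ hγ.1 ht hx (hF1.differentiableAt (by simp))
  refine ⟨_, hw1.differentiableWithinAt.hasDerivWithinAt,
    hasDerivWithinAt_derivWithin_comp_chart hφ hI hγ ht hx hF1, ?_⟩
  intro J DJ DDJ hJ hJk Y hY
  rw [← coordForm_toChart h hφ hx] at hnull hJk hY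
  rw [← coordForm_toChart h hφ hx, ← coordForm_toChart h hφ hx, hJ.eqn φ hφ t ht hx]
  obtain ⟨β, hβ⟩ := riemann_conformal_null hF hH hG (coordForm_conformal φ hU hc hx htU)
    (fun u v w => hflat φ hφ (γ t) ⟨htU, hx⟩ u v w) hnull hJk
  have h4 := congrArg (fun z => coordForm h φ (φ (γ t)) z (toChart φ (γ t) Y)) hβ
  simp only [map_smul, map_add, _root_.smul_apply, _root_.add_apply, hY, smul_eq_mul,
    φ.left_inv hx] at h4
  simp only [map_neg, _root_.neg_apply]
  linarith

end ConformalAlong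

/-! ### Uniqueness of Jacobi fields -/

/-- Grönwall's inequality forward in the parameter; the reflection s ↦ -s gives the backward
direction. -/
theorem eq_zero_of_norm_deriv_le {E : Type*} [NormedAddCommGroup E] [NormedSpace ℝ E]
    {X X' : ℝ → E} {N : Set ℝ} (hN : N.OrdConnected) {C : ℝ}
    (hX : ∀ s ∈ N, HasDerivWithinAt X (X' s) N s) (hC : ∀ s ∈ N, ‖X' s‖ ≤ C * ‖X s‖)
    {a b : ℝ} (ha : a ∈ N) (hb : b ∈ N) (h0 : X a = 0) : X b = 0 := by
  have forward : ∀ {X X' : ℝ → E} {N : Set ℝ}, N.OrdConnected →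
      (∀ s ∈ N, HasDerivWithinAt X (X' s) N s) → (∀ s ∈ N, ‖X' s‖ ≤ C * ‖X s‖) →
      ∀ {a b : ℝ}, a ∈ N → b ∈ N → a ≤ b → X a = 0 → X b = 0 := by
    intro X X' N hN hX hC a b ha hb hab h0
    have hsub : Icc a b ⊆ N := hN.out ha hb
    refine eq_zero_of_abs_deriv_le_mul_abs_self_of_eq_zero_right (f' := X') (K := C)
      (fun s hs => ((hX s (hsub hs)).continuousWithinAt).mono hsub) (fun s hs => ?_) h0
      (fun s hs => hC s (hsub (Ico_subset_Icc_self hs))) b (right_mem_Icc.2 hab)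
    have h1 := (hX s (hsub (Ico_subset_Icc_self hs))).mono
      ((Icc_subset_Icc_left hs.1).trans hsub)
    exact h1.mono_of_mem_nhdsWithin (Icc_mem_nhdsGE hs.2)
  rcases le_total a b with hab | hab
  · exact forward hN hX hC ha hb hab h0
  · have hN' : (Neg.neg ⁻¹' N).OrdConnected :=
      ⟨fun x hx y hy z hz => hN.out hy hx ⟨neg_le_neg hz.2, neg_le_neg hz.1⟩⟩
    have := forward (X := fun s => X (-s)) (X' := fun s => -X' (-s)) (N := Neg.neg ⁻¹' N) hN'
      (fun s hs => ?_) (fun s hs => by simpa using hC (-s) hs) (a := -a) (b := -b)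
      (by simpa using ha) (by simpa using hb) (neg_le_neg hab) (by simpa using h0)
    · simpa using this
    · have h1 := (hX (-s) hs).scomp s ((hasDerivAt_neg s).hasDerivWithinAt (s := Neg.neg ⁻¹' N))
        (fun x hx => hx)
      simpa [Function.comp_def] using h1

section Uniqueness

variable {M : Type*} [TopologicalSpace M] [ChartedSpace E4 M] [IsManifold 𝓘(ℝ, E4) ∞ M]
  {h : FormField M} {γ : ℝ → M} {I : Set ℝ} {t : ℝ}
  {J DJ DDJ : ∀ t, TangentSpace 𝓘(ℝ, E4) (γ t)}

theorem norm_riemann_le {G : E4 → E4 →L[ℝ] E4 →L[ℝ] ℝ} {y : E4} (hG : IsMetricAt G y)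
    (u k : E4) : ‖riemann G y u k k‖ ≤
      (2 * ‖fderiv ℝ (christoffelL G) y‖ * ‖k‖ ^ 2 + 2 * ‖christoffelL G y‖ ^ 2 * ‖k‖ ^ 2)
        * ‖u‖ := by
  have h1 : ∀ a b c, ‖fderiv ℝ (christoffelL G) y a b c‖ ≤
      ‖fderiv ℝ (christoffelL G) y‖ * ‖a‖ * ‖b‖ * ‖c‖ := fun a b c =>
    (ContinuousLinearMap.le_opNorm₂ _ b c).trans
      (by gcongr; exact ContinuousLinearMap.le_opNorm _ a)
  have h2 : ∀ a b, ‖christoffelL G y a b‖ ≤ ‖christoffelL G y‖ * ‖a‖ * ‖b‖ := fun a b =>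
    ContinuousLinearMap.le_opNorm₂ _ a b
  have h3 : ‖christoffelL G y u (christoffelL G y k k)‖ ≤
      ‖christoffelL G y‖ * ‖u‖ * (‖christoffelL G y‖ * ‖k‖ * ‖k‖) :=
    (h2 _ _).trans (by gcongr; exact h2 _ _)
  have h4 : ‖christoffelL G y k (christoffelL G y u k)‖ ≤
      ‖christoffelL G y‖ * ‖k‖ * (‖christoffelL G y‖ * ‖u‖ * ‖k‖) :=
    (h2 _ _).trans (by gcongr; exact h2 _ _)
  rw [hG.riemann_eq]
  refine (norm_sub_le _ _).trans ?_
  refine (add_le_add_left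
    ((norm_add_le _ _).trans (add_le_add_left (norm_sub_le _ _) _)) _).trans ?_
  linarith [h1 u k k, h1 k u k]

/-- Near every parameter, a Jacobi field satisfies a homogeneous linear first order system. -/
theorem IsJacobiWith.eventually_bound (hL : IsLorentzianOn h univ) (hγ : IsGeodesicOn h γ I)
    (hJ : IsJacobiWith h γ I J DJ DDJ) (ht : t ∈ I) :
    ∃ φ ∈ atlas E4 M, ∃ C : ℝ, ∃ X' : ℝ → E4 × E4, ∀ᶠ s in nhdsWithin t I, γ s ∈ φ.source ∧
      HasDerivWithinAt (fun r => (toChart φ (γ r) (J r), toChart φ (γ r) (DJ r))) (X' s) I s ∧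
      ‖X' s‖ ≤ C * ‖(toChart φ (γ s) (J s), toChart φ (γ s) (DJ s))‖ := by
  set φ := chartAt E4 (γ t)
  have hφ : φ ∈ atlas E4 M := chart_mem_atlas E4 (γ t)
  have hx : γ t ∈ φ.source := mem_chart_source E4 (γ t)
  have hG := hL.eventually_isMetricAt isOpen_univ hφ hx (mem_univ _)
  have hsm := hG.self_of_nhds.contDiffAt_christoffelL
  have hcc := (hasDerivWithinAt_chart hγ.1 hφ ht hx).continuousWithinAt
  have b1 : ContinuousWithinAt (fun s => ‖christoffelL (coordForm h φ) (φ (γ s))‖) I t :=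
    (ContinuousAt.comp_continuousWithinAt (g := christoffelL (coordForm h φ))
      (f := fun s => φ (γ s)) hsm.continuousAt hcc).norm
  have b2 : ContinuousWithinAt
      (fun s => ‖fderiv ℝ (christoffelL (coordForm h φ)) (φ (γ s))‖) I t :=
    (ContinuousAt.comp_continuousWithinAt (g := fderiv ℝ (christoffelL (coordForm h φ)))
      (f := fun s => φ (γ s)) (hsm.fderiv_right (m := ∞) (by simp)).continuousAt hcc).norm
  have b3 : ContinuousWithinAt (fun s => ‖toChart φ (γ s) (velocity γ I s)‖) I t :=
    (hγ.2 φ hφ t ht hx).continuousWithinAt.norm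
  have e1 := b1.eventually (gt_mem_nhds (lt_add_one _))
  have e2 := b2.eventually (gt_mem_nhds (lt_add_one _))
  have e3 := b3.eventually (gt_mem_nhds (lt_add_one _))
  set B1 := ‖christoffelL (coordForm h φ) (φ (γ t))‖ + 1
  set B2 := ‖fderiv ℝ (christoffelL (coordForm h φ)) (φ (γ t))‖ + 1
  set B3 := ‖toChart φ (γ t) (velocity γ I t)‖ + 1
  have hB1 : 0 ≤ B1 := by positivity
  have hB2 : 0 ≤ B2 := by positivity
  have hB3 : 0 ≤ B3 := by positivity
  refine ⟨φ, hφ, 1 + B1 * B3 + (2 * B2 * B3 ^ 2 + 2 * B1 ^ 2 * B3 ^ 2),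
    fun s => (toChart φ (γ s) (DJ s) - christoffel (coordForm h φ) (φ (γ s))
        (toChart φ (γ s) (velocity γ I s)) (toChart φ (γ s) (J s)),
      toChart φ (γ s) (DDJ s) - christoffel (coordForm h φ) (φ (γ s))
        (toChart φ (γ s) (velocity γ I s)) (toChart φ (γ s) (DJ s))), ?_⟩
  filter_upwards [e1, e2, e3, eventually_mem_source hγ.1 ht φ.open_source hx,
    self_mem_nhdsWithin] with s h1 h2 h3 h4 hs
  refine ⟨h4, (hJ.fst φ hφ s hs h4).prodMk (hJ.snd φ hφ s hs h4), ?_⟩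
  have hGs := hL.isMetricAt isOpen_univ hφ (φ.map_source h4) (mem_univ _)
  rw [hJ.eqn φ hφ s hs h4]
  set a := toChart φ (γ s) (J s)
  set b := toChart φ (γ s) (DJ s)
  set k := toChart φ (γ s) (velocity γ I s)
  have hna : ‖a‖ ≤ ‖(a, b)‖ := norm_fst_le (a, b)
  have hnb : ‖b‖ ≤ ‖(a, b)‖ := norm_snd_le (a, b)
  set n := ‖(a, b)‖
  have hn : 0 ≤ n := norm_nonneg _
  have hΓ : ∀ v : E4, ‖v‖ ≤ n → ‖christoffel (coordForm h φ) (φ (γ s)) k v‖ ≤ B1 * B3 * n := by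
    intro v hv
    rw [← christoffelL_apply]
    refine (ContinuousLinearMap.le_opNorm₂ _ _ _).trans ?_
    gcongr
  have hR : ‖riemann (coordForm h φ) (φ (γ s)) a k k‖ ≤
      (2 * B2 * B3 ^ 2 + 2 * B1 ^ 2 * B3 ^ 2) * n := by
    refine (norm_riemann_le hGs a k).trans ?_
    gcongr
  refine max_le ((norm_sub_le _ _).trans ?_) ((norm_sub_le _ _).trans ?_)
  · have : 0 ≤ (2 * B2 * B3 ^ 2 + 2 * B1 ^ 2 * B3 ^ 2) * n := by positivity
    linarith [hΓ a hna]
  · rw [norm_neg]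
    linarith [hΓ b hnb]

end Uniqueness

section JacobiUniqueness

variable {M : Type*} [TopologicalSpace M] [ChartedSpace E4 M]
  {h : FormField M} {γ : ℝ → M} {I : Set ℝ} {a t : ℝ}
  {J DJ DDJ : ∀ t, TangentSpace 𝓘(ℝ, E4) (γ t)}

theorem toChart_zero (φ : OpenPartialHomeomorph M E4) (x : M) : toChart φ x 0 = 0 :=
  map_zero (mfderiv 𝓘(ℝ, E4) 𝓘(ℝ, E4) φ x)

theorem toChart_sub_smul (φ : OpenPartialHomeomorph M E4) (x : M)
    (v w : TangentSpace 𝓘(ℝ, E4) x) (c : ℝ) :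
    toChart φ x (v - c • w) = toChart φ x v - c • toChart φ x w := by
  simp only [toChart]
  rw [map_sub, map_smul]
  rfl

variable [IsManifold 𝓘(ℝ, E4) ∞ M]

/-- A Jacobi field that vanishes together with its derivative at one parameter vanishes. -/
theorem IsJacobiWith.eq_zero (hL : IsLorentzianOn h univ) (hI : I.OrdConnected)
    (hγ : IsGeodesicOn h γ I) (hJ : IsJacobiWith h γ I J DJ DDJ) (ha : a ∈ I) (h0 : J a = 0)
    (h1 : DJ a = 0) (ht : t ∈ I) : J t = 0 := by
  -- Simultaneous vanishing of J and DJ is a locally constant property of the parameter, by Grönwall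
  -- in a chart. It propagates because I is connected.
  have key : (J a = 0 ∧ DJ a = 0) ↔ (J t = 0 ∧ DJ t = 0) := by
    refine hI.isPreconnected.induction₂ (fun x y => (J x = 0 ∧ DJ x = 0) ↔ (J y = 0 ∧ DJ y = 0))
      (fun x hx => ?_) (fun x y z _ _ _ hxy hyz => hxy.trans hyz)
      (fun x y _ _ hxy => hxy.symm) ha ht
    obtain ⟨φ, hφ, C, X', hX⟩ := hJ.eventually_bound hL hγ hx
    obtain ⟨ε, hε, hN⟩ := Metric.mem_nhdsWithin_iff.1 hX
    have hord : (Metric.ball x ε ∩ I).OrdConnected := by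
      rw [Real.ball_eq_Ioo]
      exact ordConnected_Ioo.inter hI
    have hz : ∀ s ∈ Metric.ball x ε ∩ I, (J s = 0 ∧ DJ s = 0) ↔
        (toChart φ (γ s) (J s), toChart φ (γ s) (DJ s)) = 0 := by
      intro s hs
      rw [Prod.mk_eq_zero]
      refine ⟨fun h => by rw [h.1, h.2, toChart_zero]; exact ⟨rfl, rfl⟩, fun h => ⟨?_, ?_⟩⟩
      · exact toChart_injective hφ (hN hs).1 (h.1.trans (toChart_zero φ _).symm)
      · exact toChart_injective hφ (hN hs).1 (h.2.trans (toChart_zero φ _).symm)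
    have hxN : x ∈ Metric.ball x ε ∩ I := ⟨Metric.mem_ball_self hε, hx⟩
    have hd := fun s (hs : s ∈ Metric.ball x ε ∩ I) =>
      (hN hs).2.1.mono (inter_subset_right : Metric.ball x ε ∩ I ⊆ I)
    filter_upwards [inter_mem_nhdsWithin I (Metric.ball_mem_nhds x hε)] with s hs
    have hs' : s ∈ Metric.ball x ε ∩ I := ⟨hs.2, hs.1⟩
    rw [hz x hxN, hz s hs']
    exact ⟨fun h => eq_zero_of_norm_deriv_le hord hd (fun r hr => (hN hr).2.2) hxN hs' h,
      fun h => eq_zero_of_norm_deriv_le hord hd (fun r hr => (hN hr).2.2) hs' hxN h⟩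
  exact (key.1 ⟨h0, h1⟩).1

/-- The field (s - a)γ' is Jacobi: its second covariant derivative is zero, and so is R(γ', γ')γ'.
Subtracting it removes a tangential initial derivative. -/
theorem IsJacobiWith.sub_smul_velocity (hL : IsLorentzianOn h univ) (hγ : IsGeodesicOn h γ I)
    (hJ : IsJacobiWith h γ I J DJ DDJ) (β a : ℝ) :
    IsJacobiWith h γ I (fun s => J s - (β * (s - a)) • velocity γ I s)
      (fun s => DJ s - β • velocity γ I s) DDJ := by
  refine ⟨fun φ hφ s hs hx => ?_, fun φ hφ s hs hx => ?_, fun φ hφ s hs hx => ?_⟩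
  · simp only [toChart_sub_smul]
    have hlin : HasDerivWithinAt (fun s => β * (s - a)) β I s := by
      simpa using (((hasDerivAt_id s).sub_const a).const_mul β).hasDerivWithinAt
    refine ((hJ.fst φ hφ s hs hx).sub
      (hlin.smul (hγ.hasDerivWithinAt_velocity hφ hs hx))).congr_deriv ?_
    simp only [← christoffelL_apply, map_sub, map_smul]
    module
  · simp only [toChart_sub_smul]
    refine ((hJ.snd φ hφ s hs hx).sub
      ((hγ.hasDerivWithinAt_velocity hφ hs hx).const_smul β)).congr_deriv ?_
    simp only [← christoffelL_apply, map_sub, map_smul]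
    module
  · rw [hJ.eqn φ hφ s hs hx, toChart_sub_smul]
    have hG := hL.isMetricAt isOpen_univ hφ (φ.map_source hx) (mem_univ _)
    rw [hG.riemann_eq, hG.riemann_eq]
    simp only [map_sub, map_smul, _root_.sub_apply, _root_.smul_apply]
    module

end JacobiUniqueness

/-! ### Lorentzian linear algebra -/

section LinearAlgebra

/-- Otherwise k and the three V i form a basis of the four-dimensional space, and k is orthogonal to
all of it. -/
theorem exists_null_of_orthogonal {B : E4 →L[ℝ] E4 →L[ℝ] ℝ} (hs : ∀ v w, B v w = B w v)
    (hB : ∀ v, (∀ w, B v w = 0) → v = 0) {k : E4} (hk0 : k ≠ 0) (hk : B k k = 0)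
    {V : Fin 3 → E4} (hV : ∀ i, B (V i) k = 0) (horth : ∀ i j, i ≠ j → B (V i) (V j) = 0) :
    ∃ i, B (V i) (V i) = 0 := by
  by_contra! hne
  have hli : LinearIndependent ℝ (Fin.cons k V : Fin 4 → E4) := by
    rw [Fintype.linearIndependent_iff]
    intro g hg
    rw [Fin.sum_univ_succ] at hg
    simp only [Fin.cons_zero, Fin.cons_succ] at hg
    have hg1 : ∀ i : Fin 3, g i.succ = 0 := by
      intro i
      have h1 := congrArg (fun v => B v (V i)) hg
      simp only [map_add, map_smul, map_sum, map_zero, _root_.add_apply, _root_.smul_apply,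
        _root_.sum_apply, _root_.zero_apply, hs k, hV, mul_zero, zero_add, smul_eq_mul] at h1
      rw [Finset.sum_eq_single i (fun j _ hj => by rw [horth j i hj, mul_zero]) (by simp)] at h1
      exact (mul_eq_zero.1 h1).resolve_right (hne i)
    have hg0 : g 0 = 0 := by
      simp only [hg1, zero_smul, Finset.sum_const_zero, add_zero] at hg
      exact (smul_eq_zero.1 hg).resolve_right hk0
    exact Fin.cases hg0 hg1
  let b := basisOfLinearIndependentOfCardEqFinrank hli (by simp)
  refine hk0 (hB k fun w => ?_)
  have h0 : (B k : E4 →ₗ[ℝ] ℝ) = 0 := by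
    refine b.ext fun i => ?_
    rw [coe_basisOfLinearIndependentOfCardEqFinrank]
    refine Fin.cases ?_ (fun j => ?_) i
    · simpa using hk
    · simpa [hs k] using hV j
  exact congrArg (fun l : E4 →ₗ[ℝ] ℝ => l w) h0

theorem sq_add_sq_add_sq_eq_zero {a b c : ℝ} (h : a ^ 2 + b ^ 2 + c ^ 2 = 0) :
    a = 0 ∧ b = 0 ∧ c = 0 :=
  ⟨pow_eq_zero_iff two_ne_zero |>.1 (by linarith [sq_nonneg a, sq_nonneg b, sq_nonneg c]),
    pow_eq_zero_iff two_ne_zero |>.1 (by linarith [sq_nonneg a, sq_nonneg b, sq_nonneg c]),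
    pow_eq_zero_iff two_ne_zero |>.1 (by linarith [sq_nonneg a, sq_nonneg b, sq_nonneg c])⟩

/-- With time components k₀ and v₀, the vector k₀v - v₀k is null and has no time component, hence is
zero; k₀ ≠ 0 because k is null and nonzero. -/
theorem eq_smul_of_null {B : E4 →L[ℝ] E4 →L[ℝ] ℝ} (e : Module.Basis (Fin 4) ℝ E4)
    (he : ∀ i j, B (e i) (e j) = if i = j then (if i = 0 then -1 else 1) else 0) {k v : E4}
    (hk0 : k ≠ 0) (hk : B k k = 0) (hvk : B v k = 0) (hv : B v v = 0) : ∃ β : ℝ, v = β • k := by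
  have hform : ∀ v w, B v w = - (e.repr v 0 * e.repr w 0) + e.repr v 1 * e.repr w 1
      + e.repr v 2 * e.repr w 2 + e.repr v 3 * e.repr w 3 := by
    intro v w
    conv_lhs => rw [← e.sum_repr v, ← e.sum_repr w]
    rw [Fin.sum_univ_four, Fin.sum_univ_four]
    simp [he]
  rw [hform] at hk hvk hv
  have hk00 : e.repr k 0 ≠ 0 := by
    intro h0
    rw [h0] at hk
    obtain ⟨h1, h2, h3⟩ := sq_add_sq_add_sq_eq_zero (a := e.repr k 1) (b := e.repr k 2)
      (c := e.repr k 3) (by linear_combination hk)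
    apply hk0
    rw [← e.sum_repr k, Fin.sum_univ_four, h0, h1, h2, h3]
    simp
  obtain ⟨h1, h2, h3⟩ := sq_add_sq_add_sq_eq_zero
    (a := e.repr k 0 * e.repr v 1 - e.repr v 0 * e.repr k 1)
    (b := e.repr k 0 * e.repr v 2 - e.repr v 0 * e.repr k 2)
    (c := e.repr k 0 * e.repr v 3 - e.repr v 0 * e.repr k 3)
    (by linear_combination (e.repr k 0) ^ 2 * hv + (e.repr v 0) ^ 2 * hk
      - 2 * e.repr k 0 * e.repr v 0 * hvk)
  have aux : ∀ i, e.repr k 0 * e.repr v i - e.repr v 0 * e.repr k i = 0 →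
      e.repr v i = e.repr v 0 / e.repr k 0 * e.repr k i := by
    intro i hi
    field_simp
    linarith
  refine ⟨e.repr v 0 / e.repr k 0, e.repr.injective (Finsupp.ext fun i => ?_)⟩
  rw [map_smul, Finsupp.smul_apply, smul_eq_mul]
  fin_cases i
  exacts [aux 0 (by ring), aux 1 h1, aux 2 h2, aux 3 h3]

end LinearAlgebra

/-! ### Scalar differential equations -/

section Scalar

theorem eq_of_hasDerivWithinAt_zero {f : ℝ → ℝ} {I : Set ℝ} (hI : Convex ℝ I)
    (hf : ∀ t ∈ I, HasDerivWithinAt f 0 I t) {a b : ℝ} (ha : a ∈ I) (hb : b ∈ I) : f a = f b := by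
  have := hI.norm_image_sub_le_of_norm_hasDerivWithin_le (C := 0) hf (by simp) hb ha
  rw [zero_mul] at this
  exact sub_eq_zero.1 (norm_le_zero_iff.1 this)

variable {A B B' C w w₁ f : ℝ → ℝ} {I : Set ℝ} {a b t : ℝ}

/-- For A = ⟨J, K⟩, B = ⟨J', K⟩, B' = ⟨J, K'⟩ and C = ⟨J', K'⟩ the expression is ⟨wJ' - w'J, wK' -
w'K⟩. Only these products are used, so that no parallel frame or quotient by k is needed. -/
theorem wronskian_product_const (hI : Convex ℝ I)
    (hw : ∀ t ∈ I, HasDerivWithinAt w (w₁ t) I t)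
    (hw₁ : ∀ t ∈ I, HasDerivWithinAt w₁ (f t * w t) I t)
    (hA : ∀ t ∈ I, HasDerivWithinAt A (B t + B' t) I t)
    (hB : ∀ t ∈ I, HasDerivWithinAt B (f t * A t + C t) I t)
    (hB' : ∀ t ∈ I, HasDerivWithinAt B' (C t + f t * A t) I t)
    (hC : ∀ t ∈ I, HasDerivWithinAt C (f t * B' t + f t * B t) I t) (ha : a ∈ I) (hb : b ∈ I) :
    w a ^ 2 * C a - w a * w₁ a * (B a + B' a) + w₁ a ^ 2 * A a =
      w b ^ 2 * C b - w b * w₁ b * (B b + B' b) + w₁ b ^ 2 * A b := by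
  refine eq_of_hasDerivWithinAt_zero
    (f := fun t => w t ^ 2 * C t - w t * w₁ t * (B t + B' t) + w₁ t ^ 2 * A t) hI
    (fun t ht => ?_) ha hb
  refine (((((hw t ht).fun_pow 2).fun_mul (hC t ht)).fun_sub
    (((hw t ht).fun_mul (hw₁ t ht)).fun_mul ((hB t ht).fun_add (hB' t ht)))).fun_add
    (((hw₁ t ht).fun_pow 2).fun_mul (hA t ht))).congr_deriv ?_
  push_cast
  ring

/-- The quotient ⟨wJ' - w'J, K⟩/w vanishes at a and b, and its derivative is the constant product
divided by w². Rolle's theorem yields a zero of the product. -/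
theorem wronskian_product_eq_zero (hI : Convex ℝ I)
    (hw : ∀ t ∈ I, HasDerivWithinAt w (w₁ t) I t)
    (hw₁ : ∀ t ∈ I, HasDerivWithinAt w₁ (f t * w t) I t)
    (hA : ∀ t ∈ I, HasDerivWithinAt A (B t + B' t) I t)
    (hB : ∀ t ∈ I, HasDerivWithinAt B (f t * A t + C t) I t)
    (hB' : ∀ t ∈ I, HasDerivWithinAt B' (C t + f t * A t) I t)
    (hC : ∀ t ∈ I, HasDerivWithinAt C (f t * B' t + f t * B t) I t)
    (hw0 : ∀ t ∈ I, 0 < w t) (ha : a ∈ I) (hb : b ∈ I) (hab : a < b)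
    (hA0 : A a = 0) (hB0 : B a = 0) (hA1 : A b = 0) (hB1 : B b = 0) (ht : t ∈ I) :
    w t ^ 2 * C t - w t * w₁ t * (B t + B' t) + w₁ t ^ 2 * A t = 0 := by
  have hsub : Icc a b ⊆ I := hI.ordConnected.out ha hb
  have hq : ∀ s ∈ I, HasDerivWithinAt (fun s => (w s * B s - w₁ s * A s) / w s)
      ((w s ^ 2 * C s - w s * w₁ s * (B s + B' s) + w₁ s ^ 2 * A s) / w s ^ 2) I s := by
    intro s hs
    refine ((((hw s hs).fun_mul (hB s hs)).fun_sub ((hw₁ s hs).fun_mul (hA s hs))).fun_div (hw s hs)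
      (hw0 s hs).ne').congr_deriv ?_
    congr 1
    ring
  obtain ⟨c, hc, h0⟩ := exists_hasDerivAt_eq_zero (f := fun s => (w s * B s - w₁ s * A s) / w s)
    (f' := fun s => (w s ^ 2 * C s - w s * w₁ s * (B s + B' s) + w₁ s ^ 2 * A s) / w s ^ 2) hab
    (fun s hs => (hq s (hsub hs)).continuousWithinAt.mono hsub)
    (by simp [hA0, hB0, hA1, hB1])
    (fun s hs => (hq s (hsub (Ioo_subset_Icc_self hs))).hasDerivAt
      (Filter.mem_of_superset (Icc_mem_nhds hs.1 hs.2) hsub))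
  have hcI := hsub (Ioo_subset_Icc_self hc)
  rw [wronskian_product_const hI hw hw₁ hA hB hB' hC ht hcI]
  exact (div_eq_zero_iff.1 h0).resolve_right (pow_ne_zero 2 (hw0 c hcI).ne')

end Scalar

/-! ### Jacobi fields vanishing at the starting point of a null geodesic -/

section NullGeodesic

variable {M : Type*} [TopologicalSpace M] [ChartedSpace E4 M] [IsManifold 𝓘(ℝ, E4) ∞ M]
  {h : FormField M} {U : Set M} {γ : ℝ → M} {I : Set ℝ} {a b t : ℝ}
  {J DJ DDJ K DK DDK : ∀ t, TangentSpace 𝓘(ℝ, E4) (γ t)}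

/-- The product ⟨DJ, γ'⟩ is constant, so ⟨J, γ'⟩ is affine in the parameter; having two zeros, it
vanishes, and so does its slope. -/
theorem IsJacobiWith.orthogonal_velocity (hL : IsLorentzianOn h univ) (hI : Convex ℝ I)
    (hγ : IsGeodesicOn h γ I) (hJ : IsJacobiWith h γ I J DJ DDJ) (ha : a ∈ I) (hb : b ∈ I)
    (hab : a ≠ b) (hJa : J a = 0) (hJb : J b = 0) (ht : t ∈ I) :
    h (γ t) (J t) (velocity γ I t) = 0 ∧ h (γ t) (DJ t) (velocity γ I t) = 0 := by
  have hq : ∀ s ∈ I, h (γ s) (DJ s) (velocity γ I s) = h (γ a) (DJ a) (velocity γ I a) := by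
    intro s hs
    refine eq_of_hasDerivWithinAt_zero (f := fun s => h (γ s) (DJ s) (velocity γ I s)) hI
      (fun r hr => ?_) hs ha
    refine (hasDerivWithinAt_metric hL hγ.1 hJ.snd hγ.2 hr).congr_deriv ?_
    rw [hJ.metric_velocity hL hr, map_zero, add_zero]
  set q := h (γ a) (DJ a) (velocity γ I a)
  have hp : ∀ s ∈ I, h (γ s) (J s) (velocity γ I s) - q * (s - a) = 0 := by
    intro s hs
    have := eq_of_hasDerivWithinAt_zero
      (f := fun s => h (γ s) (J s) (velocity γ I s) - q * (s - a)) hI (fun r hr => ?_) hs ha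
    · rw [this]
      simp [hJa]
    · have hlin : HasDerivWithinAt (fun s => q * (s - a)) q I r := by
        simpa using (((hasDerivAt_id r).sub_const a).const_mul q).hasDerivWithinAt
      refine ((hasDerivWithinAt_metric hL hγ.1 hJ.fst hγ.2 hr).fun_sub hlin).congr_deriv ?_
      rw [hq r hr, map_zero, add_zero, sub_self]
  have hq0 : q = 0 := by
    have := hp b hb
    rw [hJb, map_zero, _root_.zero_apply, zero_sub, neg_eq_zero, mul_eq_zero] at this
    exact this.resolve_right (sub_ne_zero.2 hab.symm)
  refine ⟨?_, by rw [hq t ht, hq0]⟩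
  have := hp t ht
  rwa [hq0, zero_mul, sub_zero] at this

/-- The Wronskian ⟨DJ, K⟩ - ⟨J, DK⟩ is constant and vanishes at a. -/
theorem IsJacobiWith.metric_deriv_symm (hL : IsLorentzianOn h univ) (hI : Convex ℝ I)
    (hγ : IsGeodesicOn h γ I) (hJ : IsJacobiWith h γ I J DJ DDJ) (hK : IsJacobiWith h γ I K DK DDK)
    (ha : a ∈ I) (hJa : J a = 0) (hKa : K a = 0) (ht : t ∈ I) :
    h (γ t) (DJ t) (K t) = h (γ t) (J t) (DK t) := by
  rw [← sub_eq_zero]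
  have := eq_of_hasDerivWithinAt_zero
    (f := fun s => h (γ s) (DJ s) (K s) - h (γ s) (J s) (DK s)) hI (fun r hr => ?_) ht ha
  · rw [this]
    simp [hJa, hKa]
  · refine ((hasDerivWithinAt_metric hL hγ.1 hJ.snd hK.fst hr).fun_sub
      (hasDerivWithinAt_metric hL hγ.1 hJ.fst hK.snd hr)).congr_deriv ?_
    rw [hJ.metric_symm hL hK hr]
    ring

/-- On a set of parameters `I₁ ⊆ I` the Jacobi fields of `γ` orthogonal to `γ` have, modulo the
velocity, the scalar tidal operator `- f`, and the positive function `w` with derivative `w₁`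
solves the equation `d²w/dt² = f w`. -/
structure IsScalarTidal (h : FormField M) (γ : ℝ → M) (I I₁ : Set ℝ) (w w₁ f : ℝ → ℝ) : Prop where
  pos : ∀ t ∈ I₁, 0 < w t
  deriv : ∀ t ∈ I₁, HasDerivWithinAt w (w₁ t) I₁ t
  deriv₁ : ∀ t ∈ I₁, HasDerivWithinAt w₁ (f t * w t) I₁ t
  tidal : ∀ t ∈ I₁, ∀ {J DJ DDJ : ∀ t, TangentSpace 𝓘(ℝ, E4) (γ t)},
    IsJacobiWith h γ I J DJ DDJ → h (γ t) (J t) (velocity γ I t) = 0 →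
    ∀ Y : TangentSpace 𝓘(ℝ, E4) (γ t), h (γ t) (velocity γ I t) Y = 0 →
    h (γ t) (DDJ t) Y = f t * h (γ t) (J t) Y

theorem IsGloballyConformallyFlatOn.exists_isScalarTidal (hL : IsLorentzianOn h univ)
    (hU : IsOpen U) (hflat : IsGloballyConformallyFlatOn h U) (hI : UniqueDiffOn ℝ I)
    (hγ : IsGeodesicOn h γ I)
    (hnull : ∀ t ∈ I, h (γ t) (velocity γ I t) (velocity γ I t) = 0) {I₁ : Set ℝ}
    (hI₁ : I₁ ⊆ I) (hγU : ∀ t ∈ I₁, γ t ∈ U) : ∃ w w₁ f, IsScalarTidal h γ I I₁ w w₁ f := by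
  obtain ⟨Ω, η, hΩ, hΩ0, hη, hηflat, hc⟩ := hflat
  have key := fun t (ht : t ∈ I₁) => hγ.conformal_factor hL hI hU hΩ hΩ0 hη hηflat hc (hI₁ ht)
    (hγU t ht) (hnull t (hI₁ ht))
  choose! w₂ h1 h2 h3 using key
  refine ⟨fun t => Ω (γ t), derivWithin (fun s => Ω (γ s)) I, fun t => w₂ t / Ω (γ t),
    fun t ht => hΩ0 _ (hγU t ht), fun t ht => (h1 t ht).mono hI₁, fun t ht => ?_,
    fun t ht J DJ DDJ hJ hJk Y hY => ?_⟩
  · rw [div_mul_cancel₀ _ (hΩ0 _ (hγU t ht)).ne']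
    exact (h2 t ht).mono hI₁
  · have h4 := h3 t ht hJ hJk Y hY
    have h0 := (hΩ0 _ (hγU t ht)).ne'
    field_simp
    linarith

variable {I₁ : Set ℝ} {w w₁ f : ℝ → ℝ}

theorem IsScalarTidal.hasDerivWithinAt_products (hT : IsScalarTidal h γ I I₁ w w₁ f)
    (hL : IsLorentzianOn h univ) (hI₁ : I₁ ⊆ I)
    (hγ : IsGeodesicOn h γ I) (hJ : IsJacobiWith h γ I J DJ DDJ) (hK : IsJacobiWith h γ I K DK DDK)
    (hJk : ∀ t ∈ I, h (γ t) (J t) (velocity γ I t) = 0 ∧ h (γ t) (DJ t) (velocity γ I t) = 0)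
    (hKk : ∀ t ∈ I, h (γ t) (K t) (velocity γ I t) = 0 ∧ h (γ t) (DK t) (velocity γ I t) = 0)
    (ht : t ∈ I₁) :
    HasDerivWithinAt (fun s => h (γ s) (J s) (K s))
      (h (γ t) (DJ t) (K t) + h (γ t) (J t) (DK t)) I₁ t ∧
    HasDerivWithinAt (fun s => h (γ s) (DJ s) (K s))
      (f t * h (γ t) (J t) (K t) + h (γ t) (DJ t) (DK t)) I₁ t ∧
    HasDerivWithinAt (fun s => h (γ s) (J s) (DK s))
      (h (γ t) (DJ t) (DK t) + f t * h (γ t) (J t) (K t)) I₁ t ∧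
    HasDerivWithinAt (fun s => h (γ s) (DJ s) (DK s))
      (f t * h (γ t) (J t) (DK t) + f t * h (γ t) (DJ t) (K t)) I₁ t := by
  have hsymm := fun v w => hL.symm (γ t) (mem_univ _) v w
  have htI := hI₁ ht
  have e1 := hT.tidal t ht hJ (hJk t htI).1 (K t) (by rw [hsymm]; exact (hKk t htI).1)
  have e2 := hT.tidal t ht hJ (hJk t htI).1 (DK t) (by rw [hsymm]; exact (hKk t htI).2)
  have e3 := hT.tidal t ht hK (hKk t htI).1 (J t) (by rw [hsymm]; exact (hJk t htI).1)
  have e4 := hT.tidal t ht hK (hKk t htI).1 (DJ t) (by rw [hsymm]; exact (hJk t htI).2)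
  rw [hsymm, hsymm (K t)] at e3 e4
  refine ⟨(hasDerivWithinAt_metric hL hγ.1 hJ.fst hK.fst htI).mono hI₁, ?_, ?_, ?_⟩
  · rw [← e1]
    exact (hasDerivWithinAt_metric hL hγ.1 hJ.snd hK.fst htI).mono hI₁
  · rw [← e3]
    exact (hasDerivWithinAt_metric hL hγ.1 hJ.fst hK.snd htI).mono hI₁
  · rw [← e2, ← e4]
    exact (hasDerivWithinAt_metric hL hγ.1 hJ.snd hK.snd htI).mono hI₁

/-- Along a null geodesic with a scalar tidal operator and a positive solution of the corresponding
scalar equation, no three parameters are conjugate to the same parameter. -/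
theorem IsScalarTidal.not_three_conjugate (hT : IsScalarTidal h γ I I₁ w w₁ f)
    (hL : IsLorentzianOn h univ) (hI : Convex ℝ I) (hI₁ : I₁ ⊆ I) (hI₁c : Convex ℝ I₁)
    (hγ : IsGeodesicOn h γ I)
    (hnull : ∀ t ∈ I, h (γ t) (velocity γ I t) (velocity γ I t) = 0)
    (hne : ∀ t ∈ I, velocity γ I t ≠ 0) {τ : Fin 3 → ℝ} (hτ : Function.Injective τ)
    (hτI : ∀ i, τ i ∈ I₁) (hconj : ∀ i, IsConjugate h γ I a (τ i)) : False := by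
  have ha : a ∈ I := (hconj 0).1
  have hex : ∀ i, ∃ J DJ DDJ : ∀ t, TangentSpace 𝓘(ℝ, E4) (γ t), IsJacobiWith h γ I J DJ DDJ ∧
      J a = 0 ∧ J (τ i) = 0 ∧ ∃ t ∈ I, J t ≠ 0 := by
    intro i
    obtain ⟨-, -, -, J, ⟨DJ, DDJ, h1, h2, h3⟩, h4⟩ := hconj i
    exact ⟨J, DJ, DDJ, ⟨h1, h2, h3⟩, h4⟩
  choose J DJ DDJ hJ hJa hJτ hJne using hex
  have hJk := fun i t (ht : t ∈ I) => (hJ i).orthogonal_velocity hL hI hγ ha (hI₁ (hτI i))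
    (hconj i).2.2.1 (hJa i) (hJτ i) ht
  have hprod := fun i j t (ht : t ∈ I₁) =>
    hT.hasDerivWithinAt_products hL hI₁ hγ (hJ i) (hJ j) (hJk i) (hJk j) ht
  have hsymm := fun t v w => hL.symm (γ t) (mem_univ _) v w
  have hcross := fun i j t (ht : t ∈ I) =>
    (hJ i).metric_deriv_symm hL hI hγ (hJ j) ha (hJa i) (hJa j) ht
  have hlt : ∀ i j, τ i < τ j → ∀ t ∈ I₁, w t ^ 2 * h (γ t) (DJ i t) (DJ j t)
      - w t * w₁ t * (h (γ t) (DJ i t) (J j t) + h (γ t) (J i t) (DJ j t))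
      + w₁ t ^ 2 * h (γ t) (J i t) (J j t) = 0 := by
    intro i j hij t ht
    refine wronskian_product_eq_zero
      (A := fun t => h (γ t) (J i t) (J j t)) (B := fun t => h (γ t) (DJ i t) (J j t))
      (B' := fun t => h (γ t) (J i t) (DJ j t)) (C := fun t => h (γ t) (DJ i t) (DJ j t)) hI₁c
      hT.deriv hT.deriv₁ (fun t ht => (hprod i j t ht).1) (fun t ht => (hprod i j t ht).2.1)
      (fun t ht => (hprod i j t ht).2.2.1) (fun t ht => (hprod i j t ht).2.2.2) hT.pos
      (hτI i) (hτI j) hij ?_ ?_ ?_ ?_ ht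
    · simp [hJτ]
    -- At τ i only J i is known to vanish, so the derivative is first moved from J i to J j.
    · simp [hcross i j _ (hI₁ (hτI i)), hJτ]
    · simp [hJτ]
    · simp [hJτ]
  -- The products of the vectors V i are constant on I₁, so any parameter of I₁ would serve.
  let s := τ 0
  have hs : s ∈ I₁ := hτI 0
  let V : Fin 3 → E4 := fun i => (w s • (DJ i s : E4) - w₁ s • (J i s : E4))
  have hVV : ∀ i j, (h (γ s) : E4 →L[ℝ] E4 →L[ℝ] ℝ) (V i) (V j) =
      w s ^ 2 * h (γ s) (DJ i s) (DJ j s)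
      - w s * w₁ s * (h (γ s) (DJ i s) (J j s) + h (γ s) (J i s) (DJ j s))
      + w₁ s ^ 2 * h (γ s) (J i s) (J j s) := by
    have expand : ∀ (B : E4 →L[ℝ] E4 →L[ℝ] ℝ) (p q : ℝ) (x y z u : E4),
        B (p • x - q • y) (p • z - q • u) =
          p ^ 2 * B x z - p * q * (B x u + B y z) + q ^ 2 * B y u := by
      intro B p q x y z u
      simp only [map_sub, map_smul, _root_.sub_apply, _root_.smul_apply, smul_eq_mul]
      ring
    exact fun i j => expand _ _ _ _ _ _ _
  have hVk : ∀ i, (h (γ s) : E4 →L[ℝ] E4 →L[ℝ] ℝ) (V i) (velocity γ I s) = 0 := by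
    have expand : ∀ (B : E4 →L[ℝ] E4 →L[ℝ] ℝ) (p q : ℝ) (x y k : E4), B x k = 0 → B y k = 0 →
        B (p • x - q • y) k = 0 := by
      intro B p q x y k hx hy
      simp [hx, hy]
    exact fun i => expand _ _ _ _ _ _ (hJk i s (hI₁ hs)).2 (hJk i s (hI₁ hs)).1
  obtain ⟨i, hi⟩ := exists_null_of_orthogonal (B := h (γ s)) (hsymm s)
    (fun v hv => hL.eq_zero (mem_univ _) hv) (hne s (hI₁ hs)) (hnull s (hI₁ hs)) hVk
    (fun i j hij => by
      rcases lt_or_gt_of_ne (hτ.ne hij) with hlt' | hgt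
      · exact (hVV i j).trans (hlt i j hlt' s hs)
      · exact (hsymm s (V i) (V j)).trans ((hVV j i).trans (hlt j i hgt s hs)))
  replace hi := (hVV i i).symm.trans hi
  have hconst := wronskian_product_const
      (A := fun t => h (γ t) (J i t) (J i t)) (B := fun t => h (γ t) (DJ i t) (J i t))
      (B' := fun t => h (γ t) (J i t) (DJ i t)) (C := fun t => h (γ t) (DJ i t) (DJ i t)) hI₁c
      hT.deriv hT.deriv₁ (fun t ht => (hprod i i t ht).1) (fun t ht => (hprod i i t ht).2.1)
      (fun t ht => (hprod i i t ht).2.2.1) (fun t ht => (hprod i i t ht).2.2.2) hs (hτI i)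
  have hτi := hI₁ (hτI i)
  -- The null property of V i is carried from s to τ i, where J i = 0 reduces V i to w times DJ i.
  have hDJ0 : h (γ (τ i)) (DJ i (τ i)) (DJ i (τ i)) = 0 := by
    have h1 := hconst.symm.trans hi
    simp only [hJτ, map_zero, _root_.zero_apply, mul_zero, add_zero, sub_zero] at h1
    exact (mul_eq_zero.1 h1).resolve_left (pow_ne_zero 2 (hT.pos _ (hτI i)).ne')
  obtain ⟨e, he⟩ := hL.signature (γ (τ i)) (mem_univ _)
  obtain ⟨β, hβ⟩ := eq_smul_of_null (B := h (γ (τ i))) e he (hne _ hτi) (hnull _ hτi)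
    (hJk i _ hτi).2 hDJ0
  have hzero : ∀ t ∈ I, J i t - (β * (t - τ i)) • velocity γ I t = 0 := fun t ht =>
    ((hJ i).sub_smul_velocity hL hγ β (τ i)).eq_zero hL hI.ordConnected hγ hτi
      (by simp [hJτ]) (sub_eq_zero.2 hβ) ht
  have hβ0 : β = 0 := by
    have h1 := hzero a ha
    rw [hJa, zero_sub, neg_eq_zero, smul_eq_zero] at h1
    exact (mul_eq_zero.1 (h1.resolve_right (hne a ha))).resolve_right
      (sub_ne_zero.2 (hconj i).2.2.1)
  obtain ⟨t, ht, hJt⟩ := hJne i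
  refine hJt ?_
  have h1 := hzero t ht
  rwa [hβ0, zero_mul, zero_smul, sub_zero] at h1

end NullGeodesic
end

/-! ### Truncated wandering null geodesics -/

theorem theorem1 {M : Type*} [TopologicalSpace M] [T2Space M] [ChartedSpace E4 M]
    [IsManifold 𝓘(ℝ, E4) ∞ M] (S : Spacetime M) (U : Set M) (hU : IsOpen U)
    (hflat : IsGloballyConformallyFlatOn S.metric U) :
    ¬ ∃ σ : ℝ → M, IsTruncatedFutureWandering S σ ∧ ∀ s ∈ Ici (0 : ℝ), σ s ∈ U := by
  rintro ⟨σ, ⟨γ, t₁, ⟨hγ, hinf⟩, hleast, hσ⟩, hσU⟩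
  have hsub : Ici t₁ ⊆ Ici (0 : ℝ) := Ici_subset_Ici.2 hleast.1.2.1
  have hγU : ∀ t ∈ Ici t₁, γ t ∈ U := by
    intro t ht
    have h0 : t - t₁ ∈ Ici (0 : ℝ) := mem_Ici.2 (sub_nonneg.2 ht)
    have h1 := hσU _ h0
    rwa [hσ _ h0, add_sub_cancel] at h1
  obtain ⟨w, w₁, f, hT⟩ := hflat.exists_isScalarTidal S.lorentzian hU (uniqueDiffOn_Ici 0)
    hγ.geodesic hγ.null hsub hγU
  -- A zero velocity would have product zero, not negative, with the time orientation.
  have hne : ∀ t ∈ Ici (0 : ℝ), velocity γ (Ici 0) t ≠ 0 := by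
    intro t ht h0
    have h1 := hγ.future t ht
    rw [h0, map_zero] at h1
    exact lt_irrefl _ h1
  let τ : Fin 3 → ℝ := fun i => hinf.natEmbedding _ i
  have hτ : ∀ i, τ i ∈ conjugateParams S γ := fun i => (hinf.natEmbedding _ i).2
  -- Minimality of t₁ places all conjugate parameters in [t₁, ∞), while the Jacobi fields live on
  -- [0, ∞).
  exact hT.not_three_conjugate S.lorentzian (convex_Ici 0) hsub (convex_Ici t₁) hγ.geodesic
    hγ.null hne (τ := τ)
    (fun i j hij => Fin.val_injective ((hinf.natEmbedding _).injective (Subtype.ext hij)))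
    (fun i => hleast.2 (hτ i)) hτ
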